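/- Let $S$ be a closed densely defined symmetric operator with equal nonzero defect numbers $\langle m,m\rangle$ in a separable complex Hilbert space $\mathfrak H$, where $\mathfrak N_\lambda=\ker(S^*-\lambda I)$ and the defect numbers of a closed symmetric operator are $\langle \dim\mathfrak N_{i},\dim\mathfrak N_{-i}\rangle$ (Hilbert dimensions; these are the dimensions of $\mathfrak N_\lambda$ for $\lambda\in\mathbb C_+$ and $\lambda\in\mathbb C_-$, respectively). A boundary triplet of $S^*$ is a Hilbert space $\mathcal H$ with linear maps $\Gamma_\pm:\mathcal D(S^*)\to\mathcal H$ such that $(\Gamma_-,\Gamma_+):\mathcal D(S^*)\to\mathcal H\oplus\mathcal H$ is surjective and $(S^*f,g)-(f,S^*g)=i[(\Gamma_+f,\Gamma_+g)-(\Gamma_-f,\Gamma_-g)]$ for all $f,g\in\mathcal D(S^*)$ (inner products linear in the first argument). Its characteristic function is the function $\Theta$ on $\mathbb C\setminus\mathbb R$ with values bounded operators in $\mathcal H$ such that $\mathcal D(S)\dotplus\mathfrak N_\lambda$ equals $\{f\in\mathcal D(S^*):\Theta(\lambda)\Gamma_+f=\Gamma_-f\}$ for $\lambda\in\mathbb C_+$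 and $\{f\in\mathcal D(S^*):\Gamma_+f=\Theta(\lambda)\Gamma_-f\}$ for $\lambda\in\mathbb C_-$. A closed densely defined symmetric operator with equal nonzero defect numbers is called a Phillips symmetric operator (PSO) if its characteristic function is constant on $\mathbb C_+$; this does not depend on the choice of the boundary triplet. A symmetric operator is called simple if its restriction to any nonzero reducing subspace is not self-adjoint, and maximal if it has no proper symmetric extension. Then: (a) $S$ is a PSO if and only if $\mathfrak H$ can be decomposed into an orthogonal sum $\mathfrak H=\mathfrak H_1\oplus\mathfrak H_2\oplus\mathfrak H_3$ of closed subspaces leaving $S$ invariant and such that $S=S_1\oplus S_2\oplus S_3$, $S_j=S\upharpoonright_{\mathfrak H_j}$, where $S_1$ and $S_2$ are simple maximal symmetric operators in $\mathfrak H_1$ and $\mathfrak H_2$ with defect numbers $\langle m,0\rangle$ and $\langle 0,m\rangle$, respectively, and $S_3$ is a self-adjoint operator in $\mathfrak H_3$. (b) If $S$ is a simple PSO and $N$ is any Hilbert space of dimension $m$, then $S$ is unitarily equivalent to the operator $i\frac{d}{dx}$ in $L_2(\mathbb R,N)$ with domain $\{u\in W_2^1(\mathbb R,N):u(0)=0\}$.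 -/

import Mathlib

open MeasureTheory
open scoped ContDiff LinearPMap

universe u

noncomputable section

namespace PhillipsSymmetric

/-! ### Unbounded operators in a complex Hilbert space

Mathlib's inner product `inner ℂ x y` is linear in the second argument. -/

section Operators

variable {H : Type u} [NormedAddCommGroup H] [InnerProductSpace ℂ H]

/-- `A` is a densely defined symmetric operator. -/
structure IsSymmetricOp (A : H →ₗ.[ℂ] H) : Prop where
  dense : Dense (A.domain : Set H)
  symm : A.IsFormalAdjoint A

/-- `A` is symmetric and has no proper symmetric extension. -/
structure IsMaximalSymmetric (A : H →ₗ.[ℂ] H) : Prop where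
  symmetric : IsSymmetricOp A
  maximal : ∀ B : H →ₗ.[ℂ] H, IsSymmetricOp B → A ≤ B → B = A

/-- The Hilbert dimension of `H` is the cardinal `m`: there is a Hilbert basis with `m` elements. -/
def HasHilbertDim (H : Type*) [NormedAddCommGroup H] [InnerProductSpace ℂ H]
    (m : Cardinal.{0}) : Prop :=
  ∃ ι : Type, Nonempty (HilbertBasis ι ℂ H) ∧ Cardinal.mk ι = m

/-- The part of `A` in the subspace `K`, as an operator in `K`: its graph consists of all pairs
`(x, y)` of elements of `K` with `x ∈ D(A)` and `A x = y`. -/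
def part (A : H →ₗ.[ℂ] H) (K : Submodule ℂ H) : K →ₗ.[ℂ] K :=
  (A.graph.comap (K.subtype.prodMap K.subtype)).toLinearPMap

theorem mem_graph_part (A : H →ₗ.[ℂ] H) (K : Submodule ℂ H) (x y : K) :
    (x, y) ∈ (part A K).graph ↔ ((x : H), (y : H)) ∈ A.graph := by
  rw [part, Submodule.toLinearPMap_graph_eq]
  · simp
  · rintro ⟨a, b⟩ hab h0
    simp only at h0
    subst h0
    have := A.graph_fst_eq_zero_snd (x := (0 : H)) (x' := (b : H)) (by simpa using hab) rfl
    simpa using this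

/-- The closed subspace `K` reduces `A`: `P A ⊆ A P` for the orthogonal projection `P` onto `K`. -/
def Reduces (A : H →ₗ.[ℂ] H) (K : Submodule ℂ H) [K.HasOrthogonalProjection] : Prop :=
  ∀ x y : H, (x, y) ∈ A.graph → (K.starProjection x, K.starProjection y) ∈ A.graph

/-- `A` is simple: the restriction of `A` to a nonzero reducing subspace is never self-adjoint. -/
def IsSimple (A : H →ₗ.[ℂ] H) : Prop :=
  ∀ (K : Submodule ℂ H) [CompleteSpace K], Reduces A K → K ≠ ⊥ → ¬ IsSelfAdjoint (part A K)

/-- `H` is the orthogonal sum of `K₁`, `K₂`, `K₃` and `A` is the orthogonal sum of its parts in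
these subspaces. -/
structure IsOrthogonalSumOfParts (A : H →ₗ.[ℂ] H) (K₁ K₂ K₃ : Submodule ℂ H) : Prop where
  orth₁₂ : K₁ ⟂ K₂
  orth₁₃ : K₁ ⟂ K₃
  orth₂₃ : K₂ ⟂ K₃
  sup_eq_top : K₁ ⊔ K₂ ⊔ K₃ = ⊤
  mem_graph_iff : ∀ (x₁ y₁ : K₁) (x₂ y₂ : K₂) (x₃ y₃ : K₃),
    ((x₁ + x₂ + x₃ : H), (y₁ + y₂ + y₃ : H)) ∈ A.graph ↔
      (x₁, y₁) ∈ (part A K₁).graph ∧ (x₂, y₂) ∈ (part A K₂).graph ∧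
        (x₃, y₃) ∈ (part A K₃).graph

/-- `A` and `B` are unitarily equivalent: `U A U⁻¹ = B` for some unitary `U`. -/
def UnitarilyEquivalent {G : Type*} [NormedAddCommGroup G] [InnerProductSpace ℂ G]
    (A : H →ₗ.[ℂ] H) (B : G →ₗ.[ℂ] G) : Prop :=
  ∃ U : H ≃ₗᵢ[ℂ] G, ∀ x y : H, (x, y) ∈ A.graph ↔ (U x, U y) ∈ B.graph

end Operators

/-! ### Defect numbers, boundary triplets, characteristic functions -/

section Phillips

variable {H : Type u} [NormedAddCommGroup H] [InnerProductSpace ℂ H] [CompleteSpace H]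

/-- The defect subspace `ker (S* - z)`. -/
def defectSpace (S : H →ₗ.[ℂ] H) (z : ℂ) : Submodule ℂ H :=
  S†.graph.comap (LinearMap.id.prod (z • LinearMap.id))

/-- `S` has defect numbers `⟨m, n⟩`: `m = dim ker (S* - i)` and `n = dim ker (S* + i)`.
For closed symmetric `S` the dimension of `ker (S* - z)` is constant on each of the two open half
planes. -/
def HasDefectNumbers (S : H →ₗ.[ℂ] H) (m n : Cardinal.{0}) : Prop :=
  HasHilbertDim (defectSpace S Complex.I) m ∧ HasHilbertDim (defectSpace S (-Complex.I)) n

/-- A boundary triplet `(G, Γ₋, Γ₊)` of `S*`. -/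
structure BoundaryTriplet (S : H →ₗ.[ℂ] H) (G : Type*) [NormedAddCommGroup G]
    [InnerProductSpace ℂ G] where
  Γm : S†.domain →ₗ[ℂ] G
  Γp : S†.domain →ₗ[ℂ] G
  green : ∀ f g : S†.domain,
    inner ℂ (g : H) (S† f) - inner ℂ (S† g) (f : H) =
      Complex.I * (inner ℂ (Γp g) (Γp f) - inner ℂ (Γm g) (Γm f))
  surjective : Function.Surjective fun f : S†.domain => (Γm f, Γp f)

/-- The domain `D(S) + ker (S* - z)` of the proper extension `A_z` of `S`. -/
def extensionDomain (S : H →ₗ.[ℂ] H) (z : ℂ) : Submodule ℂ H :=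
  S.domain ⊔ defectSpace S z

/-- `Θ` is the characteristic function of `S` associated with the boundary triplet `T`:
`D(A_z) = {f ∈ D(S*) | Θ(z) Γ₊ f = Γ₋ f}` in the upper half plane and
`D(A_z) = {f ∈ D(S*) | Γ₊ f = Θ(z) Γ₋ f}` in the lower half plane. The values of `Θ` on the real
line are irrelevant. -/
structure BoundaryTriplet.IsCharacteristicFunction {S : H →ₗ.[ℂ] H} {G : Type*}
    [NormedAddCommGroup G] [InnerProductSpace ℂ G] (T : BoundaryTriplet S G)
    (Θ : ℂ → G →L[ℂ] G) : Prop where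
  upper : ∀ z : ℂ, 0 < z.im → ∀ f : S†.domain,
    (f : H) ∈ extensionDomain S z ↔ Θ z (T.Γp f) = T.Γm f
  lower : ∀ z : ℂ, z.im < 0 → ∀ f : S†.domain,
    (f : H) ∈ extensionDomain S z ↔ T.Γp f = Θ z (T.Γm f)

/-- `S` is a Phillips symmetric operator: a closed densely defined symmetric operator with equal
nonzero defect numbers whose characteristic function is constant on the open upper half plane.
By `constant_iff` below, the choice of the boundary triplet does not matter. -/
structure IsPhillips (S : H →ₗ.[ℂ] H) : Prop where
  closed : S.IsClosed
  symmetric : IsSymmetricOp S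
  defect : ∃ m : Cardinal.{0}, m ≠ 0 ∧ HasDefectNumbers S m m
  constant : ∃ (G : Type u) (_ : NormedAddCommGroup G) (_ : InnerProductSpace ℂ G)
    (_ : CompleteSpace G) (T : BoundaryTriplet S G) (Θ : ℂ → G →L[ℂ] G),
      T.IsCharacteristicFunction Θ ∧ ∀ z w : ℂ, 0 < z.im → 0 < w.im → Θ z = Θ w

theorem eq_of_isCharacteristicFunction {S : H →ₗ.[ℂ] H}
    {G : Type*} [NormedAddCommGroup G] [InnerProductSpace ℂ G]
    {G' : Type*} [NormedAddCommGroup G'] [InnerProductSpace ℂ G']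
    {T : BoundaryTriplet S G} {T' : BoundaryTriplet S G'}
    {Θ : ℂ → G →L[ℂ] G} {Θ' : ℂ → G' →L[ℂ] G'}
    (h : T.IsCharacteristicFunction Θ) (h' : T'.IsCharacteristicFunction Θ')
    {z w : ℂ} (hz : 0 < z.im) (hw : 0 < w.im) (e : Θ z = Θ w) : Θ' z = Θ' w := by
  ext g
  obtain ⟨f, hf⟩ := T'.surjective (Θ' z g, g)
  have hm : T'.Γm f = Θ' z g := congrArg Prod.fst hf
  have hp : T'.Γp f = g := congrArg Prod.snd hf
  have h1 := (h'.upper z hz f).2 (by rw [hm, hp])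
  have h2 := (h.upper z hz f).1 h1
  rw [e] at h2
  have h3 := (h'.upper w hw f).1 ((h.upper w hw f).2 h2)
  rw [hm, hp] at h3
  exact h3.symm

/-- Constancy of the characteristic function does not depend on the boundary triplet. -/
theorem constant_iff {S : H →ₗ.[ℂ] H} {G : Type*} [NormedAddCommGroup G] [InnerProductSpace ℂ G]
    {G' : Type*} [NormedAddCommGroup G'] [InnerProductSpace ℂ G']
    {T : BoundaryTriplet S G} {T' : BoundaryTriplet S G'}
    {Θ : ℂ → G →L[ℂ] G} {Θ' : ℂ → G' →L[ℂ] G'}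
    (h : T.IsCharacteristicFunction Θ) (h' : T'.IsCharacteristicFunction Θ') :
    (∀ z w : ℂ, 0 < z.im → 0 < w.im → Θ z = Θ w) ↔
      ∀ z w : ℂ, 0 < z.im → 0 < w.im → Θ' z = Θ' w :=
  ⟨fun H z w hz hw => eq_of_isCharacteristicFunction h h' hz hw (H z w hz hw),
    fun H z w hz hw => eq_of_isCharacteristicFunction h' h hz hw (H z w hz hw)⟩

end Phillips

/-! ### The momentum operator with a point condition at `0` -/

section Momentum

variable (N : Type*) [NormedAddCommGroup N] [InnerProductSpace ℂ N]

variable {N} in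
/-- `v` is the weak derivative of `u` on the real line. -/
def HasWeakDeriv (u v : ℝ → N) : Prop :=
  ∀ φ : ℝ → ℝ, ContDiff ℝ ∞ φ → HasCompactSupport φ →
    ∫ x, deriv φ x • u x = - ∫ x, φ x • v x

variable {N} in
theorem integrable_smul_Lp {φ : ℝ → ℝ} (hφ : Continuous φ) (hc : HasCompactSupport φ)
    (f : Lp N 2 (volume : Measure ℝ)) : Integrable fun x => φ x • f x := by
  have h := ((Lp.memLp f).locallyIntegrable one_le_two)
  exact h.integrable_smul_left_of_hasCompactSupport hφ hc

/-- The graph of `i d/dx` on `{u ∈ W^{1,2}(ℝ, N) | u(0) = 0}`: the pairs `(f, i g)` in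
`L²(ℝ, N) × L²(ℝ, N)` such that `g` is the weak derivative of `f` and the continuous
representative of `f` vanishes at `0`. -/
def momentumGraph :
    Submodule ℂ (Lp N 2 (volume : Measure ℝ) × Lp N 2 (volume : Measure ℝ)) where
  carrier := {p | (∃ g : Lp N 2 (volume : Measure ℝ), HasWeakDeriv p.1 g ∧ p.2 = Complex.I • g) ∧
    ∃ u : ℝ → N, Continuous u ∧ p.1 =ᵐ[volume] u ∧ u 0 = 0}
  zero_mem' := by
    refine ⟨⟨0, ?_, by simp⟩, 0, continuous_zero, Lp.coeFn_zero _ _ _, rfl⟩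
    intro φ _ _
    have h1 : ∫ x, deriv φ x • (0 : Lp N 2 (volume : Measure ℝ)) x = ∫ _x : ℝ, (0 : N) :=
      integral_congr_ae (by simp)
    have h2 : ∫ x, φ x • (0 : Lp N 2 (volume : Measure ℝ)) x = ∫ _x : ℝ, (0 : N) :=
      integral_congr_ae (by simp)
    exact h1.trans (by rw [h2]; simp)
  add_mem' := by
    rintro ⟨f, p⟩ ⟨f', p'⟩ ⟨⟨g, hg, rfl⟩, u, hu, hfu, hu0⟩ ⟨⟨g', hg', rfl⟩, u', hu', hfu', hu0'⟩
    refine ⟨⟨g + g', ?_, by simp⟩, u + u', hu.add hu', ?_, by simp_all⟩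
    · intro φ hφ hc
      have hφ' : Continuous (deriv φ) := hφ.continuous_deriv (by simp)
      have h1 : ∫ x, deriv φ x • (f + f' : Lp N 2 (volume : Measure ℝ)) x =
          ∫ x, (deriv φ x • f x + deriv φ x • f' x) :=
        integral_congr_ae (by filter_upwards [Lp.coeFn_add f f'] with x hx; rw [hx, Pi.add_apply, smul_add])
      have h2 : ∫ x, φ x • (g + g' : Lp N 2 (volume : Measure ℝ)) x =
          ∫ x, (φ x • g x + φ x • g' x) :=
        integral_congr_ae (by filter_upwards [Lp.coeFn_add g g'] with x hx; rw [hx, Pi.add_apply, smul_add])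
      have e := hg φ hφ hc
      have e' := hg' φ hφ hc
      simp only [Prod.mk_add_mk] at e e' ⊢
      rw [h1, h2, integral_add (integrable_smul_Lp hφ' hc.deriv f)
        (integrable_smul_Lp hφ' hc.deriv f'), integral_add (integrable_smul_Lp hφ.continuous hc g)
        (integrable_smul_Lp hφ.continuous hc g'), e, e', neg_add]
    · filter_upwards [Lp.coeFn_add f f', hfu, hfu'] with x hx h1 h2
      simp_all
  smul_mem' := by
    rintro c ⟨f, p⟩ ⟨⟨g, hg, rfl⟩, u, hu, hfu, hu0⟩
    refine ⟨⟨c • g, ?_, smul_comm _ _ _⟩, c • u, hu.const_smul c, ?_, by simp_all⟩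
    · intro φ hφ hc
      have h1 : ∫ x, deriv φ x • (c • f : Lp N 2 (volume : Measure ℝ)) x =
          ∫ x, c • (deriv φ x • f x) :=
        integral_congr_ae (by
          filter_upwards [Lp.coeFn_smul c f] with x hx; rw [hx, Pi.smul_apply, smul_comm])
      have h2 : ∫ x, φ x • (c • g : Lp N 2 (volume : Measure ℝ)) x =
          ∫ x, c • (φ x • g x) :=
        integral_congr_ae (by
          filter_upwards [Lp.coeFn_smul c g] with x hx; rw [hx, Pi.smul_apply, smul_comm])
      have e := hg φ hφ hc
      simp only [Prod.smul_mk] at e ⊢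
      rw [h1, h2, integral_smul, integral_smul, e, smul_neg]
    · filter_upwards [Lp.coeFn_smul c f, hfu] with x hx h1
      simp_all

/-- The operator `i d/dx` in `L²(ℝ, N)` with domain `{u ∈ W^{1,2}(ℝ, N) | u(0) = 0}`. -/
def momentum : Lp N 2 (volume : Measure ℝ) →ₗ.[ℂ] Lp N 2 (volume : Measure ℝ) :=
  (momentumGraph N).toLinearPMap

/-- Weak derivatives are unique, so `momentumGraph` is indeed the graph of `momentum`. -/
theorem graph_momentum [CompleteSpace N] : (momentum N).graph = momentumGraph N := by
  refine Submodule.toLinearPMap_graph_eq _ ?_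
  rintro ⟨f, p⟩ ⟨⟨g, hg, rfl⟩, -⟩ h0
  simp only at h0 hg
  subst h0
  have hz : ∀ᵐ x ∂(volume : Measure ℝ), g x = 0 := by
    refine ae_eq_zero_of_integral_contDiff_smul_eq_zero
      ((Lp.memLp g).locallyIntegrable one_le_two) fun φ hφ hc => ?_
    have h1 : ∫ x, deriv φ x • (0 : Lp N 2 (volume : Measure ℝ)) x = ∫ _x : ℝ, (0 : N) :=
      integral_congr_ae (by
        simp)
    have h2 := hg φ hφ hc
    rw [h1] at h2
    simpa using h2.symm
  have : g = 0 := by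
    refine Lp.ext ?_
    filter_upwards [hz, Lp.coeFn_zero N 2 (volume : Measure ℝ)] with x h1 h2
    rw [h1, h2]; rfl
  simp [this]

end Momentum

end PhillipsSymmetric

end

namespace PhillipsSymmetric

open ComplexConjugate

/-! ### Symmetric operators, von Neumann's formula, orthogonality of defect subspaces -/

section Symmetric

variable {H : Type*} [NormedAddCommGroup H] [InnerProductSpace ℂ H] {A S : H →ₗ.[ℂ] H}

/-! Write N_z for ker(S* - z). Everything passes through one condition, `OrthogonalDefects`: N_z ⟂
N_w whenever z and w lie in opposite half planes. The characteristic function is constant on the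
upper half plane exactly when D(S) + N_z does not depend on z there. If f ∈ N_z equals a + n with a
∈ D(S) and n ∈ N_w, then (S - w)a = (z - w)f; as ran(S - w) is the orthogonal complement of N_{w̄},
this gives f ⟂ N_{w̄} for w ≠ z, and a limit argument, `inner_eq_zero_of_forall_ne`, supplies w = z.
Read backwards, the same computation gives the converse, in both half planes.

For (a), the closed spans of the N_z over the upper and over the lower half plane, together with the
common orthogonal complement `residual` of all N_z, are mutually orthogonal and reduce S
(`OrthogonalDefects.reduces`). Each part keeps the defect vectors lying in its subspace, so the
defect numbers are ⟨m,0⟩, ⟨0,m⟩ and ⟨0,0⟩. Conversely such a sum forces the orthogonality, and then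
the triplet built from von Neumann's formula has characteristic function 0.

For (b), simplicity makes `residual` vanish, so the defect vectors are total and determine the
graph: (x, y) belongs to it iff y - z̄x ⟂ N_z for all nonreal z. Modulo D(S) every N_z is a copy of
N_i or N_{-i}, and Green's identity computes the inner products within a half plane: (z - z̄')⟨f',
f⟩ = ±2i⟨n', n⟩. The vectors √2 e^{-izx}n, cut off to the half line where they decay, are total in
L²(ℝ, N), have the same Gram matrix, and determine the graph of i d/dx by the same rule; this uses
integration by parts and injectivity of the Fourier transform. The unitary matching the two families
intertwines the operators. -/

theorem IsSymmetricOp.inner_eq (hA : IsSymmetricOp A) {a b c d : H} (h : (a, b) ∈ A.graph)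
    (h' : (c, d) ∈ A.graph) : inner ℂ b c = inner ℂ a d := by
  rw [LinearPMap.mem_graph_iff] at h h'
  obtain ⟨x, rfl, rfl⟩ := h
  obtain ⟨y, rfl, rfl⟩ := h'
  exact hA.symm x y

theorem IsSymmetricOp.of_graph (hd : Dense (A.domain : Set H))
    (h : ∀ a b c d : H, (a, b) ∈ A.graph → (c, d) ∈ A.graph → inner ℂ b c = inner ℂ a d) :
    IsSymmetricOp A :=
  ⟨hd, fun x y => h _ _ _ _ (A.mem_graph x) (A.mem_graph y)⟩

theorem graph_sub_mem {a b c d : H} (h : (a, b) ∈ A.graph) (h' : (c, d) ∈ A.graph) :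
    (a - c, b - d) ∈ A.graph := A.graph.sub_mem h h'

theorem graph_add_mem {a b c d : H} (h : (a, b) ∈ A.graph) (h' : (c, d) ∈ A.graph) :
    (a + c, b + d) ∈ A.graph := A.graph.add_mem h h'

/-- As ⟨a, Aa⟩ is real, ⟨a, (A - z)a⟩ has imaginary part -Im z ‖a‖²; then Cauchy–Schwarz applies. -/
theorem IsSymmetricOp.im_mul_norm_le (hA : IsSymmetricOp A) {a b : H} (h : (a, b) ∈ A.graph)
    (z : ℂ) : |z.im| * ‖a‖ ≤ ‖b - z • a‖ := by
  have h1 : (inner ℂ a b : ℂ).im = 0 := by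
    have := hA.inner_eq h h
    rw [← inner_conj_symm] at this
    exact Complex.conj_eq_iff_im.1 this
  have h2 : (inner ℂ a (b - z • a) : ℂ).im = - (z.im * ‖a‖ ^ 2) := by
    rw [inner_sub_right, inner_smul_right, inner_self_eq_norm_sq_to_K]
    simp [h1, ← Complex.ofReal_pow]
  have h3 : |z.im| * ‖a‖ ^ 2 ≤ ‖a‖ * ‖b - z • a‖ := by
    calc |z.im| * ‖a‖ ^ 2 = |(inner ℂ a (b - z • a) : ℂ).im| := by
          rw [h2, abs_neg, abs_mul, abs_of_nonneg (sq_nonneg ‖a‖)]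
      _ ≤ ‖(inner ℂ a (b - z • a) : ℂ)‖ := Complex.abs_im_le_norm _
      _ ≤ _ := norm_inner_le_norm _ _
  rcases eq_or_ne a 0 with rfl | ha
  · simp
  · have : 0 < ‖a‖ := norm_pos_iff.2 ha
    nlinarith

theorem IsSymmetricOp.eq_zero_of_eigen (hA : IsSymmetricOp A) {a : H} {z : ℂ} (hz : z.im ≠ 0)
    (h : (a, z • a) ∈ A.graph) : a = 0 := by
  have h1 := hA.im_mul_norm_le h z
  rw [sub_self, norm_zero] at h1
  have h2 := abs_pos.2 hz
  exact norm_le_zero_iff.1 (by nlinarith [norm_nonneg a])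

/-- The range of `S - z`. -/
def rangeSub (S : H →ₗ.[ℂ] H) (z : ℂ) : Submodule ℂ H :=
  S.graph.map (LinearMap.snd ℂ H H - z • LinearMap.fst ℂ H H)

theorem mem_rangeSub {z : ℂ} {v : H} :
    v ∈ rangeSub S z ↔ ∃ a b, (a, b) ∈ S.graph ∧ b - z • a = v := by
  rw [rangeSub, Submodule.mem_map]
  exact Prod.exists

theorem sub_mem_rangeSub {z : ℂ} {a b : H} (h : (a, b) ∈ S.graph) : b - z • a ∈ rangeSub S z :=
  mem_rangeSub.2 ⟨a, b, h, rfl⟩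

variable [CompleteSpace H]

theorem mem_adjoint_graph_iff (hd : Dense (A.domain : Set H)) {x y : H} :
    (x, y) ∈ A†.graph ↔ ∀ a b, (a, b) ∈ A.graph → inner ℂ b x = inner ℂ a y := by
  rw [LinearPMap.adjoint_graph_eq_graph_adjoint hd, Submodule.mem_adjoint_iff]
  simp only [sub_eq_zero]

theorem mem_defectSpace {z : ℂ} {f : H} : f ∈ defectSpace S z ↔ (f, z • f) ∈ S†.graph := Iff.rfl

theorem defectSpace_eq (hd : Dense (S.domain : Set H)) (z : ℂ) :
    defectSpace S z = (rangeSub S (conj z))ᗮ := by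
  ext f
  rw [mem_defectSpace, mem_adjoint_graph_iff hd, Submodule.mem_orthogonal]
  constructor
  · rintro h u hu
    obtain ⟨a, b, hab, rfl⟩ := mem_rangeSub.1 hu
    rw [inner_sub_left, h a b hab, inner_smul_left, inner_smul_right]
    simp
  · intro h a b hab
    have := h _ (sub_mem_rangeSub hab)
    rw [inner_sub_left, inner_smul_left, Complex.conj_conj, sub_eq_zero] at this
    rw [this, inner_smul_right]

theorem mem_defectSpace_iff (hd : Dense (S.domain : Set H)) {z : ℂ} {f : H} :
    f ∈ defectSpace S z ↔ ∀ a b, (a, b) ∈ S.graph → inner ℂ b f = z * inner ℂ a f := by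
  rw [mem_defectSpace, mem_adjoint_graph_iff hd]
  simp only [inner_smul_right]

theorem isClosed_defectSpace (hd : Dense (S.domain : Set H)) (z : ℂ) :
    IsClosed (defectSpace S z : Set H) := by
  rw [defectSpace_eq hd]
  exact Submodule.isClosed_orthogonal _

theorem IsSymmetricOp.graph_le_adjoint (hS : IsSymmetricOp S) : S.graph ≤ S†.graph :=
  LinearPMap.le_graph_of_le (hS.symm.le_adjoint hS.dense)

/-- The bound `im_mul_norm_le` makes S - z, seen as a bounded map on the complete graph of S,
bounded below. -/
theorem isClosed_rangeSub (hc : S.IsClosed) (hS : IsSymmetricOp S) {z : ℂ} (hz : z.im ≠ 0) :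
    IsClosed (rangeSub S z : Set H) := by
  have : CompleteSpace S.graph := hc.completeSpace_coe
  set T : S.graph →L[ℂ] H :=
    (ContinuousLinearMap.snd ℂ H H - z • ContinuousLinearMap.fst ℂ H H) ∘L S.graph.subtypeL
    with hT
  have hr : (rangeSub S z : Set H) = Set.range T := by
    ext v
    constructor
    · intro hv
      obtain ⟨a, b, h, rfl⟩ := mem_rangeSub.1 hv
      exact ⟨⟨(a, b), h⟩, rfl⟩
    · rintro ⟨⟨⟨a, b⟩, h⟩, rfl⟩
      exact sub_mem_rangeSub h
  have hpos := abs_pos.2 hz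
  have hb : ∀ p : S.graph, ‖p‖ ≤ (1 + (1 + ‖z‖) / |z.im|).toNNReal * ‖T p‖ := by
    rintro ⟨⟨a, b⟩, h⟩
    have h1 := hS.im_mul_norm_le h z
    have h2 : ‖a‖ ≤ ‖b - z • a‖ / |z.im| := by rw [le_div_iff₀ hpos]; linarith
    have h3 : ‖b‖ ≤ ‖b - z • a‖ + ‖z‖ * ‖a‖ := by
      calc ‖b‖ = ‖(b - z • a) + z • a‖ := by rw [sub_add_cancel]
        _ ≤ _ := (norm_add_le _ _).trans (by rw [norm_smul])
    rw [Real.coe_toNNReal _ (by positivity)]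
    change max ‖a‖ ‖b‖ ≤ (1 + (1 + ‖z‖) / |z.im|) * ‖b - z • a‖
    have e : (1 + (1 + ‖z‖) / |z.im|) * ‖b - z • a‖ =
      ‖b - z • a‖ + ‖b - z • a‖ / |z.im| + ‖z‖ * (‖b - z • a‖ / |z.im|) := by ring
    rw [e]
    have h4 := mul_le_mul_of_nonneg_left h2 (norm_nonneg z)
    have h5 : 0 ≤ ‖b - z • a‖ / |z.im| := by positivity
    have h6 : 0 ≤ ‖z‖ * (‖b - z • a‖ / |z.im|) := by positivity
    exact max_le (by linarith [norm_nonneg (b - z • a)]) (by linarith)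
  rw [hr]
  exact (T.antilipschitz_of_bound hb).isClosed_range T.uniformContinuous

/-- Because the range is closed, its double orthogonal complement is the range itself. This is how
equations (S - z̄)a = v get solved throughout. -/
theorem mem_rangeSub_of_orthogonal (hc : S.IsClosed) (hS : IsSymmetricOp S) {z : ℂ}
    (hz : z.im ≠ 0) {v : H} (hv : v ∈ (defectSpace S z)ᗮ) : v ∈ rangeSub S (conj z) := by
  have : CompleteSpace (rangeSub S (conj z)) :=
    (isClosed_rangeSub hc hS (by simpa using hz)).completeSpace_coe
  rwa [defectSpace_eq hS.dense, Submodule.orthogonal_orthogonal] at hv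

theorem inner_defect (hd : Dense (S.domain : Set H)) {z : ℂ} {f a b : H}
    (hf : f ∈ defectSpace S z) (h : (a, b) ∈ S.graph) : inner ℂ (b - conj z • a) f = 0 := by
  rw [defectSpace_eq hd] at hf
  exact hf _ (sub_mem_rangeSub h)

theorem inner_defect' (hd : Dense (S.domain : Set H)) {z : ℂ} {f a b : H}
    (hf : f ∈ defectSpace S z) (h : (a, b) ∈ S.graph) : inner ℂ f (b - conj z • a) = 0 :=
  inner_eq_zero_symm.1 (inner_defect hd hf h)

/-- Von Neumann's formula. -/
theorem exists_vonNeumann (hc : S.IsClosed) (hS : IsSymmetricOp S) {z : ℂ} (hz : z.im ≠ 0)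
    {x y : H} (h : (x, y) ∈ S†.graph) :
    ∃ a b p q, (a, b) ∈ S.graph ∧ p ∈ defectSpace S z ∧ q ∈ defectSpace S (conj z) ∧
      x = a + p + q ∧ y = b + z • p + conj z • q := by
  have : CompleteSpace (defectSpace S z) := (isClosed_defectSpace hS.dense z).completeSpace_coe
  -- Split (S* - z̄)x along N_z ⊕ ran(S - z̄). The second summand is (S - z̄)a; the first is (z -
  -- z̄)p, since S* - z̄ acts on N_z as z - z̄. Then S* - z̄ annihilates x - a - p.
  obtain ⟨u, hu, v, hv, huv⟩ :=
    (defectSpace S z).exists_add_mem_mem_orthogonal (y - conj z • x)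
  obtain ⟨a, b, hab, rfl⟩ := mem_rangeSub.1 (mem_rangeSub_of_orthogonal hc hS hz hv)
  have hzz : z - conj z ≠ 0 := by
    rw [sub_ne_zero]
    intro e
    exact hz (Complex.conj_eq_iff_im.1 e.symm)
  set p : H := (z - conj z)⁻¹ • u with hp
  have hup : u = (z - conj z) • p := by rw [hp, smul_inv_smul₀ hzz]
  have hpm : p ∈ defectSpace S z := Submodule.smul_mem _ _ hu
  have hy : y = b + z • p + conj z • (x - a - p) := by
    rw [hup, sub_eq_iff_eq_add] at huv
    rw [huv]; module
  refine ⟨a, b, p, x - a - p, hab, hpm, ?_, by abel, hy⟩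
  rw [mem_defectSpace]
  have h1 := graph_sub_mem (graph_sub_mem h (hS.graph_le_adjoint hab))
    (mem_defectSpace.1 hpm)
  convert h1 using 2
  rw [hy]; abel

/-- The boundary form does not see the domain of `S`. -/
theorem boundaryForm_eq (hd : Dense (S.domain : Set H)) {x y x' y' a b a' b' : H}
    (h : (x, y) ∈ S†.graph) (h' : (x', y') ∈ S†.graph) (hab : (a, b) ∈ S.graph)
    (hab' : (a', b') ∈ S.graph) (hS : IsSymmetricOp S) :
    inner ℂ (x' + a') (y + b) - inner ℂ (y' + b') (x + a) = inner ℂ x' y - inner ℂ y' x := by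
  have e1 := (mem_adjoint_graph_iff hd).1 h _ _ hab'
  have e2 := (mem_adjoint_graph_iff hd).1 h' _ _ hab
  have e3 := hS.inner_eq hab' hab
  have e2' : inner ℂ x' b = inner ℂ y' a := by
    rw [← inner_conj_symm, e2, inner_conj_symm]
  simp only [inner_add_left, inner_add_right]
  rw [e1, e2', e3]; ring

theorem mem_adjoint_of_extensionDomain (hS : IsSymmetricOp S) {z : ℂ} {f : H}
    (hf : f ∈ extensionDomain S z) : f ∈ S†.domain := by
  obtain ⟨a, ha, n, hn, rfl⟩ := Submodule.mem_sup.1 hf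
  refine Submodule.add_mem _ ((hS.symm.le_adjoint hS.dense).1 ha) ?_
  exact LinearPMap.mem_domain_of_mem_graph (mem_defectSpace.1 hn)

/-- If `f ∈ ker (S* - w)` lies in `D(S) + ker (S* - z)` then `(w - z) f` is in the range
of `S - z`. -/
theorem exists_of_mem_extensionDomain (hS : IsSymmetricOp S) {z w : ℂ} {f : H}
    (hf : f ∈ defectSpace S w) (hfz : f ∈ extensionDomain S z) :
    ∃ a b n, (a, b) ∈ S.graph ∧ n ∈ defectSpace S z ∧ f = a + n ∧
      b - z • a = (w - z) • f := by
  obtain ⟨a, ha, n, hn, rfl⟩ := Submodule.mem_sup.1 hfz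
  obtain ⟨b, hab⟩ := LinearPMap.mem_domain_iff.1 ha
  refine ⟨a, b, n, hab, hn, rfl, ?_⟩
  have h1 := graph_add_mem (hS.graph_le_adjoint hab) (mem_defectSpace.1 hn)
  have h2 := LinearPMap.mem_graph_snd_inj _ h1 (mem_defectSpace.1 hf) rfl
  rw [sub_smul, ← h2]
  module

/-- Continuity in the spectral parameter: f = a + n with n ∈ N_w, and ‖a‖ → 0 as w → z, so
orthogonality of v to the neighbouring N_w passes to f. -/
theorem inner_eq_zero_of_forall_ne (hS : IsSymmetricOp S) {z : ℂ} (hz : z.im ≠ 0) {f v : H}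
    (hf : f ∈ defectSpace S z)
    (hext : ∀ w : ℂ, 0 < w.im * z.im → f ∈ extensionDomain S w)
    (hv : ∀ w : ℂ, 0 < w.im * z.im → w ≠ z → ∀ n ∈ defectSpace S w, inner ℂ v n = 0) :
    inner ℂ v f = 0 := by
  have key : ∀ t : ℝ, 0 < t → ‖(inner ℂ v f : ℂ)‖ ≤ t * (‖v‖ * ‖f‖) := by
    intro t ht
    -- Moving vertically away from the real axis keeps |Im w| ≥ |Im z| while |w - z| = t|Im z|,
    -- whence ‖a‖ ≤ t‖f‖.
    set w : ℂ := z + (t * z.im : ℝ) * Complex.I with hw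
    have him : w.im = (1 + t) * z.im := by simp [hw]; ring
    have hpos : 0 < w.im * z.im := by
      rw [him, mul_assoc]
      exact mul_pos (by linarith) (mul_self_pos.2 hz)
    have hwz : w - z = (t * z.im : ℝ) * Complex.I := by simp [hw]
    have hne : w ≠ z := by
      rw [← sub_ne_zero, hwz]
      simpa using ⟨ht.ne', hz⟩
    obtain ⟨a, b, n, hab, hn, e, h⟩ := exists_of_mem_extensionDomain hS hf (hext w hpos)
    have h1 := hS.im_mul_norm_le hab w
    rw [h, norm_smul, norm_sub_rev, hwz, him, abs_mul, abs_of_pos (by linarith : 0 < 1 + t)] at h1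
    have h2 : ‖((t * z.im : ℝ) : ℂ) * Complex.I‖ = t * |z.im| := by
      rw [norm_mul, Complex.norm_I, mul_one, Complex.norm_real, Real.norm_eq_abs, abs_mul,
        abs_of_pos ht]
    rw [h2] at h1
    have hp := abs_pos.2 hz
    have h3 : ‖a‖ ≤ t * ‖f‖ := by
      have : |z.im| * ‖a‖ ≤ |z.im| * (t * ‖f‖) := by
        have : 0 ≤ t * (|z.im| * ‖a‖) := by positivity
        nlinarith
      exact le_of_mul_le_mul_left this hp
    have h4 : (inner ℂ v f : ℂ) = inner ℂ v a := by
      rw [e, inner_add_right, hv w hpos hne n hn, add_zero]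
    rw [h4]
    calc ‖(inner ℂ v a : ℂ)‖ ≤ ‖v‖ * ‖a‖ := norm_inner_le_norm _ _
      _ ≤ ‖v‖ * (t * ‖f‖) := by gcongr
      _ = _ := by ring
  have : ‖(inner ℂ v f : ℂ)‖ ≤ 0 := by
    refine le_of_forall_pos_le_add fun ε hε => ?_
    have h := key (ε / (‖v‖ * ‖f‖ + 1)) (by positivity)
    refine h.trans ?_
    rw [zero_add, div_mul_eq_mul_div, div_le_iff₀ (by positivity)]
    nlinarith
  exact norm_le_zero_iff.1 this

/-- The defect subspaces in the upper half plane are orthogonal to those in the lower one. -/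
def OrthogonalDefects (S : H →ₗ.[ℂ] H) : Prop :=
  ∀ z w : ℂ, 0 < z.im → w.im < 0 → defectSpace S z ⟂ defectSpace S w

theorem orthogonalDefects_of_extensionDomain (hS : IsSymmetricOp S)
    (h : ∀ z w : ℂ, 0 < z.im → 0 < w.im → extensionDomain S z = extensionDomain S w) :
    OrthogonalDefects S := by
  have hext : ∀ z w : ℂ, 0 < z.im → 0 < w.im → ∀ f ∈ defectSpace S z, f ∈ extensionDomain S w :=
    fun z w hz hw f hf => h z w hz hw ▸ Submodule.mem_sup_right hf
  have hne : ∀ z w : ℂ, 0 < z.im → w.im < 0 → conj w ≠ z → ∀ f ∈ defectSpace S z,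
      ∀ g ∈ defectSpace S w, inner ℂ g f = 0 := by
    intro z w hz hw hzw f hf g hg
    obtain ⟨a, b, n, hab, hn, e, h1⟩ := exists_of_mem_extensionDomain hS hf
      (hext z (conj w) hz (by simpa using hw) f hf)
    have h2 := inner_defect' hS.dense hg hab
    rw [h1, inner_smul_right] at h2
    exact (mul_eq_zero.1 h2).resolve_left (sub_ne_zero.2 hzw.symm)
  intro z w hz hw
  rw [Submodule.isOrtho_iff_inner_eq]
  intro f hf g hg
  rw [inner_eq_zero_symm]
  refine inner_eq_zero_of_forall_ne hS hz.ne' hf (fun z' hz' => hext z z' hz ?_ f hf) ?_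
  · exact pos_of_mul_pos_left hz' hz.le
  intro z' hz' hne' n hn
  have hz'p : 0 < z'.im := pos_of_mul_pos_left hz' hz.le
  -- The direct argument `hne` fails only at z' = w̄. There the limit is taken once more, along
  -- parameters z'' ≠ z'.
  by_cases hcw : conj w = z'
  · refine inner_eq_zero_of_forall_ne hS hz'p.ne' hn (fun z' hz' => hext _ z' hz'p ?_ _ hn) ?_
    · exact pos_of_mul_pos_left hz' hz'p.le
    intro z'' hz'' hne'' n hn
    have hz''p : 0 < z''.im := pos_of_mul_pos_left hz'' hz'p.le
    exact hne z'' w hz''p hw (by rw [hcw]; exact hne''.symm) n hn g hg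
  · exact hne z' w hz'p hw hcw n hn g hg

/-- In the upper half plane, Θ z determines the extension domain, so constancy of Θ is constancy of
D(S) + N_z. -/
theorem IsPhillips.orthogonalDefects (hS : IsPhillips S) : OrthogonalDefects S := by
  obtain ⟨G, _, _, _, T, Θ, hΘ, hconst⟩ := hS.constant
  have key : ∀ z w : ℂ, 0 < z.im → 0 < w.im → extensionDomain S z ≤ extensionDomain S w := by
    intro z w hz hw f hf
    have h1 := (hΘ.upper z hz ⟨f, mem_adjoint_of_extensionDomain hS.symmetric hf⟩).1 hf
    rw [hconst z w hz hw] at h1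
    exact (hΘ.upper w hw _).2 h1
  exact orthogonalDefects_of_extensionDomain hS.symmetric fun z w hz hw =>
    le_antisymm (key z w hz hw) (key w z hw hz)

theorem OrthogonalDefects.inner_eq_zero (h : OrthogonalDefects S) {z w : ℂ}
    (hzw : z.im * w.im < 0) {f g : H} (hf : f ∈ defectSpace S z) (hg : g ∈ defectSpace S w) :
    inner ℂ f g = 0 := by
  rcases mul_neg_iff.1 hzw with ⟨hz, hw⟩ | ⟨hz, hw⟩
  · exact Submodule.isOrtho_iff_inner_eq.1 (h z w hz hw) f hf g hg
  · exact Submodule.isOrtho_iff_inner_eq.1 (h w z hw hz).symm f hf g hg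

/-- Orthogonality of f to N_{w̄} gives f = (S - w)a, and then f - (z - w)a is annihilated by S* - w.
-/
theorem OrthogonalDefects.mem_extensionDomain (h : OrthogonalDefects S) (hc : S.IsClosed)
    (hS : IsSymmetricOp S) {z w : ℂ} (hzw : 0 < w.im * z.im) {f : H} (hf : f ∈ defectSpace S z) :
    f ∈ extensionDomain S w := by
  have hw : (conj w).im ≠ 0 := by
    rw [Complex.conj_im, neg_ne_zero]
    rintro h0
    simp [h0] at hzw
  have h1 : f ∈ (defectSpace S (conj w))ᗮ := by
    intro g hg
    refine h.inner_eq_zero ?_ hg hf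
    rw [Complex.conj_im]; linarith
  have h2 := mem_rangeSub_of_orthogonal hc hS hw h1
  rw [Complex.conj_conj] at h2
  obtain ⟨a, b, hab, he⟩ := mem_rangeSub.1 h2
  have h3 : f - (z - w) • a ∈ defectSpace S w := by
    rw [mem_defectSpace]
    have := graph_sub_mem (mem_defectSpace.1 hf)
      (hS.graph_le_adjoint (S.graph.smul_mem (z - w) hab))
    convert this using 2
    have hb : b = f + w • a := by rw [← he]; abel
    rw [hb]
    module
  have h4 := Submodule.smul_mem S.domain (z - w) (LinearPMap.mem_domain_of_mem_graph hab)
  have h5 := Submodule.add_mem_sup h4 h3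
  rwa [add_sub_cancel] at h5

theorem OrthogonalDefects.extensionDomain_eq (h : OrthogonalDefects S) (hc : S.IsClosed)
    (hS : IsSymmetricOp S) {z w : ℂ} (hzw : 0 < w.im * z.im) :
    extensionDomain S z = extensionDomain S w :=
  le_antisymm (sup_le le_sup_left fun _ hf => h.mem_extensionDomain hc hS hzw hf)
    (sup_le le_sup_left fun _ hf => h.mem_extensionDomain hc hS (by rwa [mul_comm]) hf)

end Symmetric

end PhillipsSymmetric

namespace PhillipsSymmetric

open ComplexConjugate

/-! ### Hilbert dimension -/

section HilbertDim

variable {E F : Type*} [NormedAddCommGroup E] [InnerProductSpace ℂ E]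
  [NormedAddCommGroup F] [InnerProductSpace ℂ F] {m : Cardinal.{0}}

theorem HasHilbertDim.congr (h : HasHilbertDim E m) (e : E ≃ₗᵢ[ℂ] F) : HasHilbertDim F m := by
  obtain ⟨ι, ⟨b⟩, hm⟩ := h
  exact ⟨ι, ⟨HilbertBasis.ofRepr (e.symm.trans b.repr)⟩, hm⟩

theorem HasHilbertDim.nonempty_linearIsometryEquiv [CompleteSpace E]
    (hE : HasHilbertDim E m) (hF : HasHilbertDim F m) : Nonempty (E ≃ₗᵢ[ℂ] F) := by
  obtain ⟨ι, ⟨b⟩, hm⟩ := hE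
  obtain ⟨κ, ⟨c⟩, hm'⟩ := hF
  obtain ⟨e⟩ := Cardinal.eq.1 (hm'.trans hm.symm)
  have hsp : ⊤ ≤ (Submodule.span ℂ (Set.range (b ∘ e))).topologicalClosure := by
    rw [Set.range_comp, e.range_eq_univ, Set.image_univ, b.dense_span]
  exact ⟨(HilbertBasis.mk (b.orthonormal.comp e e.injective) hsp).repr.trans c.repr.symm⟩

theorem hasHilbertDim_zero_iff [CompleteSpace E] : HasHilbertDim E 0 ↔ Subsingleton E := by
  constructor
  · rintro ⟨ι, ⟨b⟩, h⟩
    have : IsEmpty ι := Cardinal.mk_eq_zero_iff.1 h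
    refine ⟨fun x y => b.repr.injective ?_⟩
    ext i
    exact isEmptyElim i
  · intro h
    refine ⟨Empty, ⟨HilbertBasis.mk (v := fun i : Empty => i.elim) ⟨nofun, nofun⟩ ?_⟩, by simp⟩
    intro x _
    rw [Subsingleton.elim x 0]
    exact zero_mem _

end HilbertDim

/-! ### Parts of an operator in reducing subspaces and their defect subspaces -/

section Parts

variable {H : Type*} [NormedAddCommGroup H] [InnerProductSpace ℂ H] {A S : H →ₗ.[ℂ] H}
  {K : Submodule ℂ H}

theorem Reduces.mem_part [K.HasOrthogonalProjection] (h : Reduces S K) {x y : H}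
    (hxy : (x, y) ∈ S.graph) :
    (K.orthogonalProjectionOnto x, K.orthogonalProjectionOnto y) ∈ (part S K).graph :=
  (mem_graph_part S K _ _).2 (h x y hxy)

theorem Reduces.orthogonal [K.HasOrthogonalProjection] (h : Reduces S K) : Reduces S Kᗮ := by
  intro x y hxy
  rw [Submodule.starProjection_orthogonal_val, Submodule.starProjection_orthogonal_val]
  exact graph_sub_mem hxy (h x y hxy)

theorem Reduces.dense_part [K.HasOrthogonalProjection] (h : Reduces S K)
    (hd : Dense (S.domain : Set H)) : Dense ((part S K).domain : Set K) := by
  have h1 : DenseRange K.orthogonalProjectionOnto := by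
    refine Function.Surjective.denseRange fun k => ⟨k, ?_⟩
    simp
  refine (h1.dense_image K.orthogonalProjectionOnto.continuous hd).mono ?_
  rintro _ ⟨x, hx, rfl⟩
  obtain ⟨y, hy⟩ := LinearPMap.mem_domain_iff.1 hx
  exact LinearPMap.mem_domain_of_mem_graph (h.mem_part hy)

theorem Reduces.isSymmetricOp_part [K.HasOrthogonalProjection] (h : Reduces S K)
    (hS : IsSymmetricOp S) : IsSymmetricOp (part S K) := by
  refine IsSymmetricOp.of_graph (h.dense_part hS.dense) fun a b c d hab hcd => ?_
  exact hS.inner_eq ((mem_graph_part S K _ _).1 hab) ((mem_graph_part S K _ _).1 hcd)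

theorem isClosed_part (hS : S.IsClosed) : (part S K).IsClosed := by
  have : ((part S K).graph : Set (K × K)) = Prod.map Subtype.val Subtype.val ⁻¹' (S.graph : Set (H × H)) := by
    ext ⟨x, y⟩
    exact mem_graph_part S K x y
  rw [LinearPMap.IsClosed, this]
  exact IsClosed.preimage (by fun_prop) hS

theorem inner_orthogonalProjectionOnto_eq [K.HasOrthogonalProjection] (a : K) (f : H) :
    inner ℂ a (K.orthogonalProjectionOnto f) = inner ℂ (a : H) f :=
  Submodule.inner_orthogonalProjectionOnto_eq_of_mem_left a f

theorem inner_orthogonalProjectionOnto_eq' [K.HasOrthogonalProjection] (a : K) (f : H) :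
    inner ℂ (K.orthogonalProjectionOnto f) a = inner ℂ f (a : H) :=
  Submodule.inner_orthogonalProjectionOnto_eq_of_mem_right a f

variable [CompleteSpace H] [CompleteSpace K]

theorem Reduces.orthogonalProjectionOnto_mem_defectSpace (h : Reduces S K)
    (hd : Dense (S.domain : Set H)) {z : ℂ} {f : H} (hf : f ∈ defectSpace S z) :
    K.orthogonalProjectionOnto f ∈ defectSpace (part S K) z := by
  rw [mem_defectSpace_iff (h.dense_part hd)]
  intro a b hab
  rw [inner_orthogonalProjectionOnto_eq, inner_orthogonalProjectionOnto_eq]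
  exact (mem_defectSpace_iff hd).1 hf _ _ ((mem_graph_part S K _ _).1 hab)

/-- For f ∈ K, pairing f with a vector is pairing it with the projection of that vector to K, and
projection carries the graph of S into the graph of the part. -/
theorem Reduces.mem_defectSpace_part (h : Reduces S K) (hd : Dense (S.domain : Set H)) {z : ℂ}
    {f : K} : f ∈ defectSpace (part S K) z ↔ (f : H) ∈ defectSpace S z := by
  constructor
  · intro hf
    rw [mem_defectSpace_iff hd]
    intro a b hab
    rw [← inner_orthogonalProjectionOnto_eq', ← inner_orthogonalProjectionOnto_eq']
    exact (mem_defectSpace_iff (h.dense_part hd)).1 hf _ _ (h.mem_part hab)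
  · intro hf
    have := h.orthogonalProjectionOnto_mem_defectSpace hd hf
    rwa [Submodule.orthogonalProjectionOnto_mem_subspace_eq_self] at this

theorem Reduces.hasHilbertDim_defectSpace_part (h : Reduces S K) (hd : Dense (S.domain : Set H))
    {z : ℂ} (hz : defectSpace S z ≤ K) {m : Cardinal.{0}} (hm : HasHilbertDim (defectSpace S z) m) :
    HasHilbertDim (defectSpace (part S K) z) m :=
  hm.congr
    { toFun := fun f => ⟨⟨f, hz f.2⟩, (h.mem_defectSpace_part hd).2 f.2⟩
      invFun := fun f => ⟨f.1, (h.mem_defectSpace_part hd).1 f.2⟩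
      left_inv := fun _ => rfl
      right_inv := fun _ => rfl
      map_add' := fun _ _ => rfl
      map_smul' := fun _ _ => rfl
      norm_map' := fun _ => rfl }

theorem Reduces.defectSpace_part_eq_bot (h : Reduces S K) (hd : Dense (S.domain : Set H))
    {z : ℂ} (hz : defectSpace S z ≤ Kᗮ) : defectSpace (part S K) z = ⊥ := by
  rw [eq_bot_iff]
  intro f hf
  have h1 := hz ((h.mem_defectSpace_part hd).1 hf) f f.2
  rw [Submodule.mem_bot]
  exact Subtype.ext (inner_self_eq_zero.1 h1)

theorem Reduces.defectSpace_le_orthogonal (h : Reduces S K) (hd : Dense (S.domain : Set H))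
    {z : ℂ} (hz : defectSpace (part S K) z = ⊥) : defectSpace S z ≤ Kᗮ := by
  intro f hf
  have h1 := h.orthogonalProjectionOnto_mem_defectSpace hd hf
  rw [hz, Submodule.mem_bot] at h1
  intro k hk
  rw [← inner_orthogonalProjectionOnto_eq ⟨k, hk⟩, h1, inner_zero_right]

end Parts

/-! ### Self-adjointness, maximality, simplicity and the residual subspace -/

section Criteria

variable {H : Type*} [NormedAddCommGroup H] [InnerProductSpace ℂ H] [CompleteSpace H]
  {S : H →ₗ.[ℂ] H}

theorem isSelfAdjoint_of_defectSpace_eq_bot (hc : S.IsClosed) (hS : IsSymmetricOp S) {z : ℂ}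
    (hz : z.im ≠ 0) (h : defectSpace S z = ⊥) (h' : defectSpace S (conj z) = ⊥) :
    IsSelfAdjoint S := by
  rw [LinearPMap.isSelfAdjoint_def]
  refine LinearPMap.eq_of_eq_graph (le_antisymm ?_ hS.graph_le_adjoint)
  rintro ⟨x, y⟩ hxy
  obtain ⟨a, b, p, q, hab, hp, hq, rfl, rfl⟩ := exists_vonNeumann hc hS hz hxy
  rw [h, Submodule.mem_bot] at hp
  rw [h', Submodule.mem_bot] at hq
  simpa [hp, hq] using hab

theorem defectSpace_eq_bot_of_isSelfAdjoint (hS : IsSelfAdjoint S) {z : ℂ} (hz : z.im ≠ 0) :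
    defectSpace S z = ⊥ := by
  have hd := hS.dense_domain
  have hS' := LinearPMap.isSelfAdjoint_def.1 hS
  have hsymm : IsSymmetricOp S := by
    refine ⟨hd, ?_⟩
    have := LinearPMap.adjoint_isFormalAdjoint hd
    rwa [hS'] at this
  rw [eq_bot_iff]
  intro f hf
  rw [mem_defectSpace, hS'] at hf
  exact hsymm.eq_zero_of_eigen hz hf

/-- If N_z = 0, then S - z̄ is already onto, while B - z̄ is injective for every symmetric extension
B. -/
theorem isMaximalSymmetric_of_defectSpace_eq_bot (hc : S.IsClosed) (hS : IsSymmetricOp S) {z : ℂ}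
    (hz : z.im ≠ 0) (h : defectSpace S z = ⊥) : IsMaximalSymmetric S := by
  refine ⟨hS, fun B hB hle => (LinearPMap.eq_of_eq_graph (le_antisymm
    (LinearPMap.le_graph_of_le hle) ?_)).symm⟩
  rintro ⟨x, y⟩ hxy
  have h1 : y - conj z • x ∈ (defectSpace S z)ᗮ := by simp [h]
  obtain ⟨a, b, hab, e⟩ := mem_rangeSub.1 (mem_rangeSub_of_orthogonal hc hS hz h1)
  have h2 := graph_sub_mem hxy (LinearPMap.le_graph_of_le hle hab)
  have h3 : y - b = conj z • (x - a) := by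
    rw [smul_sub, sub_eq_sub_iff_sub_eq_sub, ← e]
  rw [h3] at h2
  have h4 := hB.eq_zero_of_eigen (by simpa using hz) h2
  rw [h4, smul_zero, sub_eq_zero] at h3
  rw [sub_eq_zero] at h4
  rwa [h4, h3]

omit [CompleteSpace H] in
-- This is the isometry of the Cayley transform.
theorem IsSymmetricOp.norm_sub_conj_smul (hS : IsSymmetricOp S) {a b : H} (h : (a, b) ∈ S.graph)
    (z : ℂ) : ‖b - conj z • a‖ = ‖b - z • a‖ := by
  have h1 : (inner ℂ b a : ℂ).im = 0 := by
    have h2 := inner_conj_symm (𝕜 := ℂ) b a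
    rw [← hS.inner_eq h h] at h2
    exact Complex.conj_eq_iff_im.1 h2
  rw [← sq_eq_sq₀ (norm_nonneg _) (norm_nonneg _), @norm_sub_sq ℂ, @norm_sub_sq ℂ,
    inner_smul_right, inner_smul_right, norm_smul, norm_smul]
  simp [h1]

/-- Whether the defect subspaces vanish depends only on the half plane. -/
theorem defectSpace_eq_bot_of_eq_bot (hc : S.IsClosed) (hS : IsSymmetricOp S) {w z : ℂ}
    (hwz : 0 < w.im * z.im) (h : defectSpace S w = ⊥) : defectSpace S z = ⊥ := by
  have hw : w.im ≠ 0 := by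
    intro h0
    simp [h0] at hwz
  rw [eq_bot_iff]
  intro f hf
  have h1 : f ∈ (defectSpace S w)ᗮ := by simp [h]
  obtain ⟨a, b, hab, e⟩ := mem_rangeSub.1 (mem_rangeSub_of_orthogonal hc hS hw h1)
  have h2 := inner_defect' hS.dense hf hab
  have h3 := hS.norm_sub_conj_smul hab w
  rw [e] at h3
  -- Here f = b - w̄a has the same norm as b - wa, and f ⟂ b - z̄a. Pairing this identity with f
  -- gives |w - z̄|‖f‖² ≤ |z - w|‖f‖², impossible for f ≠ 0 because z is closer to w than z̄ is.
  have h4 : (w - conj w) • (b - conj z • a) =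
      (w - conj z) • f + (conj z - conj w) • (b - w • a) := by
    rw [← e]; module
  have h5 : (w - conj z) * inner ℂ f f + (conj z - conj w) * inner ℂ f (b - w • a) = 0 := by
    rw [← inner_smul_right, ← inner_smul_right, ← inner_add_right, ← h4, inner_smul_right, h2,
      mul_zero]
  have h6 : ‖w - conj z‖ * ‖f‖ ^ 2 ≤ ‖z - w‖ * ‖f‖ ^ 2 := by
    calc ‖w - conj z‖ * ‖f‖ ^ 2 = ‖(w - conj z) * inner ℂ f f‖ := by
          rw [norm_mul, inner_self_eq_norm_sq_to_K]; simp
      _ = ‖(conj z - conj w) * inner ℂ f (b - w • a)‖ := by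
          rw [eq_neg_of_add_eq_zero_left h5, norm_neg]
      _ ≤ ‖conj z - conj w‖ * (‖f‖ * ‖b - w • a‖) := by
          rw [norm_mul]; gcongr; exact norm_inner_le_norm _ _
      _ = _ := by rw [← h3, ← map_sub, RCLike.norm_conj]; ring
  have h7 : ‖z - w‖ < ‖w - conj z‖ := by
    rw [← sq_lt_sq₀ (norm_nonneg _) (norm_nonneg _), ← Complex.normSq_eq_norm_sq,
      ← Complex.normSq_eq_norm_sq, Complex.normSq_apply, Complex.normSq_apply]
    simp only [Complex.sub_re, Complex.sub_im, Complex.conj_re, Complex.conj_im]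
    nlinarith
  rw [Submodule.mem_bot]
  by_contra hf0
  have : 0 < ‖f‖ ^ 2 := by positivity
  nlinarith

/-- The orthogonal complement of all defect subspaces. -/
noncomputable def residual (S : H →ₗ.[ℂ] H) : Submodule ℂ H :=
  ⨅ z : {z : ℂ // z.im ≠ 0}, (defectSpace S z)ᗮ

theorem mem_residual {h : H} :
    h ∈ residual S ↔ ∀ z : ℂ, z.im ≠ 0 → ∀ n ∈ defectSpace S z, inner ℂ n h = 0 := by
  simp [residual, Submodule.mem_iInf, Submodule.mem_orthogonal]

theorem isClosed_residual : IsClosed (residual S : Set H) := by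
  rw [residual, Submodule.coe_iInf]
  exact isClosed_iInter fun _ => Submodule.isClosed_orthogonal _

theorem defectSpace_le_residual_orthogonal {z : ℂ} (hz : z.im ≠ 0) :
    defectSpace S z ≤ (residual S)ᗮ :=
  fun f hf _ hh => inner_eq_zero_symm.1 (mem_residual.1 hh z hz f hf)

/-- A self-adjoint part has no defect vectors, so its subspace is orthogonal to every N_z and lies
in the residual subspace. -/
theorem isSimple_of_residual_eq_bot (hS : IsSymmetricOp S) (h : residual S = ⊥) : IsSimple S := by
  intro K _ hK hne hsa
  refine hne (eq_bot_iff.2 fun k hk => ?_)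
  rw [← h, mem_residual]
  intro z hz n hn
  exact inner_eq_zero_symm.1 (hK.defectSpace_le_orthogonal hS.dense
    (defectSpace_eq_bot_of_isSelfAdjoint hsa hz) hn k hk)

/-- A single parameter may be left out, by the limit argument. It will be the one at which an
equation was solved, where dividing by z̄₀ - z̄ is impossible. -/
theorem OrthogonalDefects.mem_residual_of_forall_ne (ho : OrthogonalDefects S) (hc : S.IsClosed)
    (hS : IsSymmetricOp S) {z₀ : ℂ} {h : H}
    (hh : ∀ z : ℂ, z.im ≠ 0 → z ≠ z₀ → ∀ n ∈ defectSpace S z, inner ℂ n h = 0) :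
    h ∈ residual S := by
  rw [mem_residual]
  intro z hz n hn
  by_cases e : z = z₀
  · rw [inner_eq_zero_symm]
    refine inner_eq_zero_of_forall_ne hS hz hn
      (fun w hw => ho.mem_extensionDomain hc hS hw hn) fun w hw hne n' hn' => ?_
    rw [inner_eq_zero_symm]
    refine hh w ?_ (e ▸ hne) n' hn'
    intro h0
    simp [h0] at hw
  · exact hh z hz e n hn

/-- A closed subspace that contains or annihilates each defect subspace, and whose complement
contains the residual subspace, reduces `S`. -/
theorem OrthogonalDefects.reduces (ho : OrthogonalDefects S) (hc : S.IsClosed)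
    (hS : IsSymmetricOp S) {K : Submodule ℂ H} [CompleteSpace K] (hr : residual S ≤ Kᗮ)
    (hK : ∀ z : ℂ, z.im ≠ 0 → defectSpace S z ≤ K ∨ defectSpace S z ≤ Kᗮ) : Reduces S K := by
  intro x y hxy
  set X := K.starProjection x with hX
  set Y := K.starProjection y with hY
  have h1 : ∀ z : ℂ, z.im ≠ 0 → ∀ n ∈ defectSpace S z, inner ℂ n (Y - conj z • X) = 0 := by
    intro z hz n hn
    have e : Y - conj z • X = K.starProjection (y - conj z • x) := by
      rw [map_sub, map_smul]
    rw [e]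
    rcases hK z hz with hle | hle
    · rw [← Submodule.inner_starProjection_left_eq_right,
        Submodule.starProjection_eq_self_iff.2 (hle hn)]
      exact inner_defect' hS.dense hn hxy
    · exact inner_eq_zero_symm.1 (hle hn _ (Submodule.starProjection_apply_mem K _))
  have hI : (Complex.I).im ≠ 0 := by simp
  have hI' : (-Complex.I).im ≠ 0 := by simp
  -- Solve (S + i)s = Y + iX in D(S); the aim is s = X, and then s' = Y follows.
  obtain ⟨s, s', hs, he⟩ := mem_rangeSub.1 (mem_rangeSub_of_orthogonal hc hS hI
    (v := Y - conj Complex.I • X) (h1 _ hI))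
  have hYs : Y - s' = conj Complex.I • (X - s) := by
    rw [smul_sub, sub_eq_sub_iff_sub_eq_sub, ← he]
  have hres : X - s ∈ residual S := by
    refine ho.mem_residual_of_forall_ne hc hS (z₀ := Complex.I) fun z hz hne n hn => ?_
    have h2 : inner ℂ n ((Y - s') - conj z • (X - s)) = 0 := by
      have e : (Y - s') - conj z • (X - s) = (Y - conj z • X) - (s' - conj z • s) := by module
      rw [e, inner_sub_right, h1 z hz n hn, inner_defect' hS.dense hn hs, sub_zero]
    rw [hYs, ← sub_smul, inner_smul_right, ← map_sub] at h2
    refine (mul_eq_zero.1 h2).resolve_left ?_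
    exact (map_ne_zero _).2 (sub_ne_zero.2 hne.symm)
  -- Write X - s = (S - i)t, where t is again residual. By symmetry ⟨s, (S - i)t⟩ = ⟨(S + i)s, t⟩ =
  -- ⟨Y + iX, t⟩, which vanishes since Y + iX ∈ K and t ∈ Kᗮ.
  have hsorth : inner ℂ s (X - s) = 0 := by
    obtain ⟨t, t', ht, hk⟩ := mem_rangeSub.1 (mem_rangeSub_of_orthogonal hc hS hI'
      (v := X - s) (fun n hn => mem_residual.1 hres _ hI' n hn))
    have htres : t ∈ residual S := by
      refine ho.mem_residual_of_forall_ne hc hS (z₀ := -Complex.I) fun z hz hne n hn => ?_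
      have h2 := inner_defect' hS.dense hn ht
      have h3 := mem_residual.1 hres z hz n hn
      rw [← hk] at h3
      have e : (t' - conj z • t) - (t' - conj (-Complex.I) • t) =
        (conj (-Complex.I) - conj z) • t := by module
      have h4 : inner ℂ n ((conj (-Complex.I) - conj z) • t) = 0 := by
        rw [← e, inner_sub_right, h2, h3, sub_zero]
      rw [inner_smul_right, ← map_sub] at h4
      refine (mul_eq_zero.1 h4).resolve_left ?_
      exact (map_ne_zero _).2 (sub_ne_zero.2 hne.symm)
    have h5 : inner ℂ (s' - conj Complex.I • s) t = 0 := by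
      rw [he]
      refine hr htres _ ?_
      exact K.sub_mem (K.starProjection_apply_mem _) (K.smul_mem _ (K.starProjection_apply_mem _))
    rw [← hk, inner_sub_right, ← hS.inner_eq hs ht, ← h5, inner_sub_left, inner_smul_left,
      inner_smul_right]
    simp
  have hXorth : inner ℂ X (X - s) = 0 := hr hres _ (K.starProjection_apply_mem _)
  have h0 : X - s = 0 := by
    rw [← inner_self_eq_zero (𝕜 := ℂ), inner_sub_left, hXorth, hsorth, sub_zero]
  rw [h0, smul_zero, sub_eq_zero] at hYs
  rw [sub_eq_zero] at h0
  rwa [h0, hYs]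

instance : CompleteSpace (residual S) := isClosed_residual.completeSpace_coe

/-- The complement of the residual subspace contains every N_z, so `reduces` applies to it;
reduction then passes back to its complement. -/
theorem OrthogonalDefects.reduces_residual (ho : OrthogonalDefects S) (hc : S.IsClosed)
    (hS : IsSymmetricOp S) : Reduces S (residual S) := by
  have h1 : Reduces S (residual S)ᗮ :=
    ho.reduces hc hS (Submodule.le_orthogonal_orthogonal _)
      fun z hz => Or.inl (defectSpace_le_residual_orthogonal hz)
  intro x y hxy
  have := h1.orthogonal x y hxy
  simpa only [Submodule.orthogonal_orthogonal] using this

theorem OrthogonalDefects.isSelfAdjoint_residual (ho : OrthogonalDefects S) (hc : S.IsClosed)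
    (hS : IsSymmetricOp S) : IsSelfAdjoint (part S (residual S)) := by
  have hr := ho.reduces_residual hc hS
  have hI : (Complex.I).im ≠ 0 := by simp
  refine isSelfAdjoint_of_defectSpace_eq_bot (isClosed_part hc) (hr.isSymmetricOp_part hS) hI ?_ ?_
  · exact hr.defectSpace_part_eq_bot hS.dense (defectSpace_le_residual_orthogonal hI)
  · exact hr.defectSpace_part_eq_bot hS.dense (defectSpace_le_residual_orthogonal (by simp))

theorem OrthogonalDefects.residual_eq_bot (ho : OrthogonalDefects S) (hc : S.IsClosed)
    (hS : IsSymmetricOp S) (hs : IsSimple S) : residual S = ⊥ := by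
  by_contra hne
  exact hs _ (ho.reduces_residual hc hS) hne (ho.isSelfAdjoint_residual hc hS)

end Criteria

end PhillipsSymmetric

namespace PhillipsSymmetric

open ComplexConjugate

/-! ### The orthogonal decomposition and its converse -/

section Decomposition

variable {H : Type*} [NormedAddCommGroup H] [InnerProductSpace ℂ H] {S : H →ₗ.[ℂ] H}
  {K₁ K₂ K₃ : Submodule ℂ H}

theorem starProjection_add_of_mem {K : Submodule ℂ H} [K.HasOrthogonalProjection] {k l : H}
    (hk : k ∈ K) (hl : l ∈ Kᗮ) : K.starProjection (k + l) = k :=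
  Submodule.eq_starProjection_of_mem_orthogonal' hk hl rfl

theorem IsOrthogonalSumOfParts.swap₁₂ (h : IsOrthogonalSumOfParts S K₁ K₂ K₃) :
    IsOrthogonalSumOfParts S K₂ K₁ K₃ where
  orth₁₂ := h.orth₁₂.symm
  orth₁₃ := h.orth₂₃
  orth₂₃ := h.orth₁₃
  sup_eq_top := by rw [sup_comm K₂]; exact h.sup_eq_top
  mem_graph_iff x₁ y₁ x₂ y₂ x₃ y₃ := by
    rw [add_comm (x₁ : H), add_comm (y₁ : H), h.mem_graph_iff]; tauto

theorem IsOrthogonalSumOfParts.swap₁₃ (h : IsOrthogonalSumOfParts S K₁ K₂ K₃) :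
    IsOrthogonalSumOfParts S K₃ K₂ K₁ where
  orth₁₂ := h.orth₂₃.symm
  orth₁₃ := h.orth₁₃.symm
  orth₂₃ := h.orth₁₂.symm
  sup_eq_top := by rw [sup_comm K₃, sup_right_comm, sup_comm K₂]; exact h.sup_eq_top
  mem_graph_iff x₁ y₁ x₂ y₂ x₃ y₃ := by
    have e : ∀ a b c : H, a + b + c = c + b + a := fun a b c => by abel
    rw [e x₁, e y₁, h.mem_graph_iff]; tauto

theorem IsOrthogonalSumOfParts.reduces [CompleteSpace K₁]
    (h : IsOrthogonalSumOfParts S K₁ K₂ K₃) : Reduces S K₁ := by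
  have key : ∀ v : H, ∃ (a : K₁) (b : K₂) (c : K₃), v = a + b + c ∧ K₁.starProjection v = a := by
    intro v
    have hv : v ∈ K₁ ⊔ K₂ ⊔ K₃ := h.sup_eq_top ▸ Submodule.mem_top
    obtain ⟨d, hd, c, hc, rfl⟩ := Submodule.mem_sup.1 hv
    obtain ⟨a, ha, b, hb, rfl⟩ := Submodule.mem_sup.1 hd
    refine ⟨⟨a, ha⟩, ⟨b, hb⟩, ⟨c, hc⟩, rfl, ?_⟩
    rw [add_assoc]
    exact starProjection_add_of_mem ha (K₁ᗮ.add_mem (h.orth₁₂.symm hb) (h.orth₁₃.symm hc))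
  intro x y hxy
  obtain ⟨a, b, c, rfl, hx⟩ := key x
  obtain ⟨a', b', c', rfl, hy⟩ := key y
  rw [hx, hy]
  exact (mem_graph_part S K₁ _ _).1 ((h.mem_graph_iff a a' b b' c c').1 hxy).1

theorem IsOrthogonalSumOfParts.mem_of_mem_orthogonal [CompleteSpace K₂] [CompleteSpace K₃]
    (h : IsOrthogonalSumOfParts S K₁ K₂ K₃) {v : H} (h₂ : v ∈ K₂ᗮ) (h₃ : v ∈ K₃ᗮ) : v ∈ K₁ := by
  have hv : v ∈ K₁ ⊔ K₂ ⊔ K₃ := h.sup_eq_top ▸ Submodule.mem_top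
  obtain ⟨d, hd, c, hc, rfl⟩ := Submodule.mem_sup.1 hv
  obtain ⟨a, ha, b, hb, rfl⟩ := Submodule.mem_sup.1 hd
  have hb0 : b = 0 := by
    have h1 := h₂ b hb
    rw [inner_add_right, inner_add_right, Submodule.isOrtho_iff_inner_eq.1 h.orth₁₂.symm b hb a ha,
      Submodule.isOrtho_iff_inner_eq.1 h.orth₂₃ b hb c hc, zero_add, add_zero] at h1
    exact inner_self_eq_zero.1 h1
  have hc0 : c = 0 := by
    have h1 := h₃ c hc
    rw [inner_add_right, inner_add_right, Submodule.isOrtho_iff_inner_eq.1 h.orth₁₃.symm c hc a ha,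
      Submodule.isOrtho_iff_inner_eq.1 h.orth₂₃.symm c hc b hb, zero_add, zero_add] at h1
    exact inner_self_eq_zero.1 h1
  rw [hb0, hc0, add_zero, add_zero]
  exact ha

theorem isOrthogonalSumOfParts_of_reduces [CompleteSpace K₁] [CompleteSpace K₂]
    [CompleteSpace K₃] (h₁₂ : K₁ ⟂ K₂) (h₁₃ : K₁ ⟂ K₃) (h₂₃ : K₂ ⟂ K₃)
    (htop : K₁ ⊔ K₂ ⊔ K₃ = ⊤) (hr₁ : Reduces S K₁) (hr₂ : Reduces S K₂) (hr₃ : Reduces S K₃) :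
    IsOrthogonalSumOfParts S K₁ K₂ K₃ := by
  refine ⟨h₁₂, h₁₃, h₂₃, htop, fun x₁ y₁ x₂ y₂ x₃ y₃ => ?_⟩
  simp only [mem_graph_part]
  have e₁ : ∀ (a : K₁) (b : K₂) (c : K₃), K₁.starProjection (a + b + c : H) = a := fun a b c => by
    rw [add_assoc]
    exact starProjection_add_of_mem a.2 (K₁ᗮ.add_mem (h₁₂.symm b.2) (h₁₃.symm c.2))
  have e₂ : ∀ (a : K₁) (b : K₂) (c : K₃), K₂.starProjection (a + b + c : H) = b := fun a b c => by
    rw [add_right_comm, add_comm]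
    exact starProjection_add_of_mem b.2 (K₂ᗮ.add_mem (h₁₂ a.2) (h₂₃.symm c.2))
  have e₃ : ∀ (a : K₁) (b : K₂) (c : K₃), K₃.starProjection (a + b + c : H) = c := fun a b c => by
    rw [add_comm]
    exact starProjection_add_of_mem c.2 (K₃ᗮ.add_mem (h₁₃ a.2) (h₂₃ b.2))
  constructor
  · intro h
    refine ⟨?_, ?_, ?_⟩
    · simpa only [e₁] using hr₁ _ _ h
    · simpa only [e₂] using hr₂ _ _ h
    · simpa only [e₃] using hr₃ _ _ h
  · rintro ⟨h1, h2, h3⟩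
    exact graph_add_mem (graph_add_mem h1 h2) h3

variable [CompleteSpace H]

theorem Reduces.defectSpace_le_orthogonal_of_half_plane {K : Submodule ℂ H} [CompleteSpace K]
    (hr : Reduces S K) (hc : S.IsClosed) (hS : IsSymmetricOp S) {w z : ℂ}
    (hwz : 0 < w.im * z.im) (h : defectSpace (part S K) w = ⊥) : defectSpace S z ≤ Kᗮ :=
  hr.defectSpace_le_orthogonal hS.dense
    (defectSpace_eq_bot_of_eq_bot (S := part S K) (isClosed_part hc) (hr.isSymmetricOp_part hS)
      hwz h)

/-- A defect subspace of a part that vanishes at ±i vanishes on that whole half plane. Hence upper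
defect vectors of S are orthogonal to K₂ and K₃, so lie in K₁, while lower ones are orthogonal to
K₁. -/
theorem OrthogonalDefects.of_sum [CompleteSpace K₁] [CompleteSpace K₂] [CompleteSpace K₃]
    (hc : S.IsClosed) (hS : IsSymmetricOp S) (h : IsOrthogonalSumOfParts S K₁ K₂ K₃)
    (h₁ : defectSpace (part S K₁) (-Complex.I) = ⊥) (h₂ : defectSpace (part S K₂) Complex.I = ⊥)
    (h₃ : IsSelfAdjoint (part S K₃)) : OrthogonalDefects S := by
  intro z w hz hw
  have hz₂ : defectSpace S z ≤ K₂ᗮ :=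
    h.swap₁₂.reduces.defectSpace_le_orthogonal_of_half_plane hc hS (w := Complex.I)
      (by rwa [Complex.I_im, one_mul]) h₂
  have hz₃ : defectSpace S z ≤ K₃ᗮ :=
    h.swap₁₃.reduces.defectSpace_le_orthogonal hS.dense
      (defectSpace_eq_bot_of_isSelfAdjoint h₃ hz.ne')
  have hw₁ : defectSpace S w ≤ K₁ᗮ :=
    h.reduces.defectSpace_le_orthogonal_of_half_plane hc hS (w := -Complex.I)
      (by rw [Complex.neg_im, Complex.I_im]; linarith) h₁
  have hz₁ : defectSpace S z ≤ K₁ := fun f hf => h.mem_of_mem_orthogonal (hz₂ hf) (hz₃ hf)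
  exact (Submodule.isOrtho_orthogonal_right K₁).mono hz₁ hw₁

/-- The closed linear span of the defect subspaces `ker (S* - z)` with `z ∈ s`. -/
noncomputable def defectSpan (S : H →ₗ.[ℂ] H) (s : Set ℂ) : Submodule ℂ H :=
  (⨆ z : s, defectSpace S z).topologicalClosure

instance (s : Set ℂ) : CompleteSpace (defectSpan S s) :=
  (Submodule.isClosed_topologicalClosure _).completeSpace_coe

theorem defectSpace_le_defectSpan {s : Set ℂ} {z : ℂ} (hz : z ∈ s) :
    defectSpace S z ≤ defectSpan S s :=
  (le_iSup (fun z : s => defectSpace S z) ⟨z, hz⟩).trans (Submodule.le_topologicalClosure _)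

theorem defectSpan_le {s : Set ℂ} {K : Submodule ℂ H} (hK : IsClosed (K : Set H))
    (h : ∀ z ∈ s, defectSpace S z ≤ K) : defectSpan S s ≤ K :=
  Submodule.topologicalClosure_minimal _ (iSup_le fun z => h z z.2) hK

/-- The part of `S` in the span of the defect subspaces of one half plane. -/
theorem OrthogonalDefects.part_defectSpan (ho : OrthogonalDefects S) (hc : S.IsClosed)
    (hS : IsSymmetricOp S) {s : Set ℂ} {z₀ : ℂ} (hz₀ : z₀.im ≠ 0)
    (hs : s = {z | 0 < z₀.im * z.im}) {m : Cardinal.{0}} (hm : HasHilbertDim (defectSpace S z₀) m) :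
    Reduces S (defectSpan S s) ∧ IsSimple (part S (defectSpan S s)) ∧
      IsMaximalSymmetric (part S (defectSpan S s)) ∧
      HasHilbertDim (defectSpace (part S (defectSpan S s)) z₀) m ∧
      HasHilbertDim (defectSpace (part S (defectSpan S s)) (conj z₀)) 0 := by
  have hle : ∀ z, z ∈ s → defectSpace S z ≤ defectSpan S s := fun z => defectSpace_le_defectSpan
  have hne : ∀ z ∈ s, z.im ≠ 0 := by
    rintro z hz h0
    simp [hs, h0] at hz
  have hort : ∀ z : ℂ, z.im ≠ 0 → z ∉ s → defectSpace S z ≤ (defectSpan S s)ᗮ := by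
    intro z hz hzs
    rw [hs, Set.mem_ofPred_eq, not_lt] at hzs
    rw [← Submodule.isOrtho_iff_le]
    refine (Submodule.IsOrtho.symm ?_)
    rw [Submodule.isOrtho_iff_le]
    refine defectSpan_le (Submodule.isClosed_orthogonal _) fun w hw f hf g hg => ?_
    refine ho.inner_eq_zero ?_ hg hf
    have hneg : z₀.im * z.im < 0 := lt_of_le_of_ne hzs (mul_ne_zero hz₀ hz)
    have hw' : 0 < z₀.im * w.im := by rwa [hs] at hw
    rcases lt_or_gt_of_ne hz₀ with h | h
    · exact mul_neg_of_pos_of_neg (by nlinarith) (by nlinarith)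
    · exact mul_neg_of_neg_of_pos (by nlinarith) (by nlinarith)
  have hres : residual S ≤ (defectSpan S s)ᗮ := by
    rw [Submodule.le_orthogonal_iff_le_orthogonal]
    exact defectSpan_le (Submodule.isClosed_orthogonal _) fun z hz =>
      defectSpace_le_residual_orthogonal (hne z hz)
  have hred : Reduces S (defectSpan S s) := ho.reduces hc hS hres fun z hz => by
    by_cases h : z ∈ s
    exacts [Or.inl (hle z h), Or.inr (hort z hz h)]
  have hz₀s : z₀ ∈ s := by rw [hs]; exact mul_self_pos.2 hz₀
  have hconj : (conj z₀) ∉ s := by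
    rw [hs, Set.mem_ofPred_eq, Complex.conj_im]
    nlinarith [mul_self_nonneg z₀.im]
  have hz₀' : (conj z₀).im ≠ 0 := by simpa using hz₀
  have hbot := hred.defectSpace_part_eq_bot hS.dense (hort _ hz₀' hconj)
  have hsym := hred.isSymmetricOp_part hS
  refine ⟨hred, ?_, isMaximalSymmetric_of_defectSpace_eq_bot (isClosed_part hc) hsym hz₀' hbot,
    hred.hasHilbertDim_defectSpace_part hS.dense (hle _ hz₀s) hm, ?_⟩
  -- A residual vector k of the part is orthogonal to all N_z with z ∈ s, hence to their closed
  -- span, which contains k.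
  · refine isSimple_of_residual_eq_bot hsym (eq_bot_iff.2 fun k hk => ?_)
    have hk' : (k : H) ∈ (defectSpan S s)ᗮ := by
      refine (Submodule.le_orthogonal_iff_le_orthogonal.1 (defectSpan_le
        (K := (ℂ ∙ (k : H))ᗮ) (Submodule.isClosed_orthogonal _) fun z hz n hn => ?_))
        (Submodule.mem_span_singleton_self _)
      rw [Submodule.mem_orthogonal_singleton_iff_inner_left]
      exact mem_residual.1 hk z (hne z hz) ⟨n, hle z hz hn⟩
        ((hred.mem_defectSpace_part hS.dense).2 hn)
    rw [Submodule.mem_bot]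
    exact Subtype.ext (inner_self_eq_zero.1 (hk' k k.2))
  · rw [hbot, hasHilbertDim_zero_iff]
    infer_instance

theorem OrthogonalDefects.exists_decomposition (ho : OrthogonalDefects S) (hc : S.IsClosed)
    (hS : IsSymmetricOp S) {m : Cardinal.{0}} (hdef : HasDefectNumbers S m m) :
    ∃ (K₁ K₂ K₃ : Submodule ℂ H)
      (_ : CompleteSpace K₁) (_ : CompleteSpace K₂) (_ : CompleteSpace K₃),
      IsOrthogonalSumOfParts S K₁ K₂ K₃ ∧
      (IsSimple (part S K₁) ∧ IsMaximalSymmetric (part S K₁) ∧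
        HasDefectNumbers (part S K₁) m 0) ∧
      (IsSimple (part S K₂) ∧ IsMaximalSymmetric (part S K₂) ∧
        HasDefectNumbers (part S K₂) 0 m) ∧
      IsSelfAdjoint (part S K₃) := by
  obtain ⟨hr₁, hs₁, hm₁, hd₁, hd₁'⟩ := ho.part_defectSpan hc hS (s := {z | 0 < z.im})
    (z₀ := Complex.I) (by simp) (by simp) hdef.1
  obtain ⟨hr₂, hs₂, hm₂, hd₂, hd₂'⟩ := ho.part_defectSpan hc hS (s := {z | z.im < 0})
    (z₀ := -Complex.I) (by simp) (by simp) hdef.2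
  rw [Complex.conj_I] at hd₁'
  rw [map_neg, Complex.conj_I, neg_neg] at hd₂'
  have h₁₂ : defectSpan S {z | 0 < z.im} ⟂ defectSpan S {z | z.im < 0} := by
    rw [Submodule.isOrtho_iff_le]
    refine defectSpan_le (Submodule.isClosed_orthogonal _) fun z hz => ?_
    rw [← Submodule.isOrtho_iff_le]
    refine Submodule.IsOrtho.symm ?_
    rw [Submodule.isOrtho_iff_le]
    exact defectSpan_le (Submodule.isClosed_orthogonal _) fun w hw =>
      Submodule.isOrtho_iff_le.1 (ho z w hz hw).symm
  have h₁₃ : defectSpan S {z | 0 < z.im} ⟂ residual S := by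
    rw [Submodule.isOrtho_iff_le]
    exact defectSpan_le (Submodule.isClosed_orthogonal _) fun z hz =>
      defectSpace_le_residual_orthogonal (ne_of_gt hz)
  have h₂₃ : defectSpan S {z | z.im < 0} ⟂ residual S := by
    rw [Submodule.isOrtho_iff_le]
    exact defectSpan_le (Submodule.isClosed_orthogonal _) fun z hz =>
      defectSpace_le_residual_orthogonal (ne_of_lt hz)
  refine ⟨_, _, residual S, inferInstance, inferInstance, inferInstance,
    isOrthogonalSumOfParts_of_reduces h₁₂ h₁₃ h₂₃ ?_ hr₁ hr₂ (ho.reduces_residual hc hS),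
    ⟨hs₁, hm₁, hd₁, hd₁'⟩, ⟨hs₂, hm₂, hd₂', hd₂⟩, ho.isSelfAdjoint_residual hc hS⟩
  set K₁ := defectSpan S {z | 0 < z.im}
  set K₂ := defectSpan S {z | z.im < 0}
  rw [eq_top_iff]
  intro v _
  -- Removing both projections leaves a vector orthogonal to every N_z, since each N_z lies in K₁ or
  -- in K₂.
  have hv : v = K₁.starProjection v + K₂.starProjection v +
    (v - K₁.starProjection v - K₂.starProjection v) := by abel
  rw [hv]
  refine Submodule.add_mem_sup (Submodule.add_mem_sup (K₁.starProjection_apply_mem v)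
    (K₂.starProjection_apply_mem v)) (mem_residual.2 fun z hz n hn => ?_)
  rcases lt_or_gt_of_ne hz with h | h
  · have hn' : n ∈ K₂ := defectSpace_le_defectSpan (s := {z : ℂ | z.im < 0}) h hn
    rw [sub_right_comm, inner_sub_right, (K₂.sub_starProjection_mem_orthogonal v) n hn',
      Submodule.isOrtho_iff_inner_eq.1 h₁₂.symm n hn' _ (K₁.starProjection_apply_mem v), sub_zero]
  · have hn' : n ∈ K₁ := defectSpace_le_defectSpan (s := {z : ℂ | 0 < z.im}) h hn
    rw [inner_sub_right, (K₁.sub_starProjection_mem_orthogonal v) n hn',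
      Submodule.isOrtho_iff_inner_eq.1 h₁₂ n hn' _ (K₂.starProjection_apply_mem v), sub_zero]

end Decomposition

/-! ### A boundary triplet from von Neumann's formula -/

section Triplet

variable {H : Type u} [NormedAddCommGroup H] [InnerProductSpace ℂ H] [CompleteSpace H]
  {S : H →ₗ.[ℂ] H}

/-- Up to a scalar, the component p in von Neumann's formula is the projection of (S* - z̄)f to N_z.
So p depends linearly on f and not on the chosen decomposition. -/
theorem orthogonalProjectionOnto_defectSpace (hd : Dense (S.domain : Set H)) {z : ℂ}
    [(defectSpace S z).HasOrthogonalProjection] {a b p q : H}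
    (hab : (a, b) ∈ S.graph) (hp : p ∈ defectSpace S z) :
    (defectSpace S z).orthogonalProjectionOnto
      ((b + z • p + conj z • q) - conj z • (a + p + q)) = (z - conj z) • ⟨p, hp⟩ := by
  have e : (b + z • p + conj z • q) - conj z • (a + p + q) =
    (z - conj z) • p + (b - conj z • a) := by module
  rw [e]
  exact Subtype.ext (starProjection_add_of_mem (Submodule.smul_mem _ _ hp)
    fun n hn => inner_defect' hd hn hab)

theorem exists_vonNeumann_I (hc : S.IsClosed) (hS : IsSymmetricOp S) (f : S†.domain) :
    ∃ a b p q, (a, b) ∈ S.graph ∧ p ∈ defectSpace S Complex.I ∧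
      q ∈ defectSpace S (-Complex.I) ∧ (f : H) = a + p + q ∧
      S† f = b + Complex.I • p + (-Complex.I) • q := by
  simpa only [Complex.conj_I] using
    exists_vonNeumann hc hS (z := Complex.I) (by simp) (S†.mem_graph f)

theorem exists_mem_adjoint_domain (p : defectSpace S Complex.I) (q : defectSpace S (-Complex.I)) :
    ∃ f : S†.domain, (f : H) = p + q ∧
      S† f = Complex.I • (p : H) + (-Complex.I) • (q : H) := by
  have h := graph_add_mem (mem_defectSpace.1 p.2) (mem_defectSpace.1 q.2)
  obtain ⟨f, h1, h2⟩ := (S†.mem_graph_iff).1 h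
  exact ⟨f, h1, h2⟩

theorem exists_boundaryMaps (hS : IsSymmetricOp S)
    (J : defectSpace S (-Complex.I) ≃ₗᵢ[ℂ] defectSpace S Complex.I) :
    ∃ Γm Γp : S†.domain →ₗ[ℂ] defectSpace S Complex.I,
      ∀ (f : S†.domain) (a b : H) (p : defectSpace S Complex.I)
        (q : defectSpace S (-Complex.I)), (a, b) ∈ S.graph → (f : H) = a + p + q →
        S† f = b + Complex.I • (p : H) + (-Complex.I) • (q : H) →
        Γp f = (Complex.I - 1) • p ∧ Γm f = (1 - Complex.I) • J q := by
  have : CompleteSpace (defectSpace S Complex.I) :=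
    (isClosed_defectSpace hS.dense _).completeSpace_coe
  have : CompleteSpace (defectSpace S (-Complex.I)) :=
    (isClosed_defectSpace hS.dense _).completeSpace_coe
  -- The projections return 2ip and -2iq, and c turns the factors ±2i into i - 1 and 1 - i. Their
  -- squared modulus 2 is the one Green's identity demands; this choice avoids √2.
  set c : ℂ := (1 + Complex.I) / 2 with hcdef
  refine ⟨c • (J.toLinearEquiv.toLinearMap ∘ₗ
      ((defectSpace S (-Complex.I)).orthogonalProjectionOnto : H →ₗ[ℂ] _) ∘ₗ
      ((S†).toFun - Complex.I • S†.domain.subtype)),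
    c • (((defectSpace S Complex.I).orthogonalProjectionOnto : H →ₗ[ℂ] _) ∘ₗ
      ((S†).toFun - (-Complex.I) • S†.domain.subtype)), fun f a b p q hab hf hf' => ?_⟩
  have hp := orthogonalProjectionOnto_defectSpace (q := (q : H)) hS.dense hab p.2
  have hq := orthogonalProjectionOnto_defectSpace (q := (p : H)) hS.dense hab q.2
  rw [Complex.conj_I, ← hf', ← hf] at hp
  rw [map_neg, Complex.conj_I, neg_neg, add_right_comm b, ← hf', add_right_comm a, ← hf] at hq
  constructor
  · change c • (defectSpace S Complex.I).orthogonalProjectionOnto (S† f - (-Complex.I) • (f : H)) = _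
    rw [hp, smul_smul]
    congr 1
    rw [hcdef]
    linear_combination Complex.I_mul_I
  · change c • J ((defectSpace S (-Complex.I)).orthogonalProjectionOnto
      (S† f - Complex.I • (f : H))) = _
    rw [hq, map_smul, smul_smul]
    congr 1
    rw [hcdef]
    linear_combination - Complex.I_mul_I

/-- On N_i ⊕ N_{-i} the boundary form is 2i(⟨p', p⟩ - ⟨q', q⟩), the cross terms cancelling, and D(S)
does not contribute. The isometry J moves q to the space of p. -/
theorem exists_boundaryTriplet (hc : S.IsClosed) (hS : IsSymmetricOp S)
    (J : defectSpace S (-Complex.I) ≃ₗᵢ[ℂ] defectSpace S Complex.I) :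
    ∃ T : BoundaryTriplet S (defectSpace S Complex.I),
      ∀ (f : S†.domain) (a b : H) (p : defectSpace S Complex.I)
        (q : defectSpace S (-Complex.I)), (a, b) ∈ S.graph → (f : H) = a + p + q →
        S† f = b + Complex.I • (p : H) + (-Complex.I) • (q : H) →
        T.Γp f = (Complex.I - 1) • p ∧ T.Γm f = (1 - Complex.I) • J q := by
  obtain ⟨Γm, Γp, hΓ⟩ := exists_boundaryMaps hS J
  have hnorm : conj (Complex.I - 1) * (Complex.I - 1) = 2 := by
    rw [map_sub, Complex.conj_I, map_one]
    linear_combination - Complex.I_mul_I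
  have hne : Complex.I - 1 ≠ 0 := fun h => by simp [h] at hnorm
  refine ⟨⟨Γm, Γp, fun f g => ?_, ?_⟩, hΓ⟩
  · obtain ⟨a, b, p, q, hab, hp, hq, hf, hf'⟩ := exists_vonNeumann_I hc hS f
    obtain ⟨a', b', p', q', hab', hp', hq', hg, hg'⟩ := exists_vonNeumann_I hc hS g
    obtain ⟨e1, e2⟩ := hΓ f a b ⟨p, hp⟩ ⟨q, hq⟩ hab hf hf'
    obtain ⟨e1', e2'⟩ := hΓ g a' b' ⟨p', hp'⟩ ⟨q', hq'⟩ hab' hg hg'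
    have h := boundaryForm_eq hS.dense
      (graph_add_mem (mem_defectSpace.1 hp) (mem_defectSpace.1 hq))
      (graph_add_mem (mem_defectSpace.1 hp') (mem_defectSpace.1 hq')) hab hab' hS
    have r : ∀ u v w : H, u + v + w = v + w + u := fun u v w => by abel
    rw [e1, e2, e1', e2', hf', hg', hf, hg, r a, r b, r a', r b', h]
    have r1 : inner ℂ ((Complex.I - 1) • (⟨p', hp'⟩ : defectSpace S Complex.I))
        ((Complex.I - 1) • ⟨p, hp⟩) = 2 * inner ℂ p' p := by
      rw [inner_smul_left, inner_smul_right, ← mul_assoc, hnorm]; rfl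
    have r2 : inner ℂ ((1 - Complex.I) • J ⟨q', hq'⟩) ((1 - Complex.I) • J ⟨q, hq⟩) =
        2 * inner ℂ q' q := by
      rw [← neg_sub, neg_smul, neg_smul, inner_neg_neg, inner_smul_left, inner_smul_right,
        ← mul_assoc, hnorm, J.inner_map_map]; rfl
    rw [r1, r2]
    simp only [inner_add_left, inner_add_right, inner_smul_left, inner_smul_right, map_neg,
      Complex.conj_I]
    ring
  · rintro ⟨u, v⟩
    obtain ⟨f, hf, hf'⟩ := exists_mem_adjoint_domain ((Complex.I - 1)⁻¹ • v)
      (J.symm ((1 - Complex.I)⁻¹ • u))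
    obtain ⟨e1, e2⟩ := hΓ f 0 0 ((Complex.I - 1)⁻¹ • v) (J.symm ((1 - Complex.I)⁻¹ • u))
      (Submodule.zero_mem _) (by rw [hf, zero_add]) (by rw [hf', zero_add])
    have hne' : 1 - Complex.I ≠ 0 := by rwa [← neg_sub, neg_ne_zero]
    refine ⟨f, Prod.ext ?_ ?_⟩
    · change Γm f = u
      rw [e2, J.apply_symm_apply, smul_inv_smul₀ hne']
    · change Γp f = v
      rw [e1, smul_inv_smul₀ hne]

/-- In this triplet Γ₋ vanishes exactly on D(S) + N_i and Γ₊ exactly on D(S) + N_{-i}. As the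
extension domains depend only on the half plane, Θ = 0 serves for all z. -/
theorem OrthogonalDefects.isPhillips (ho : OrthogonalDefects S) (hc : S.IsClosed)
    (hS : IsSymmetricOp S) {m : Cardinal.{0}} (hm : m ≠ 0) (hdef : HasDefectNumbers S m m) :
    IsPhillips S := by
  have hcp : CompleteSpace (defectSpace S Complex.I) :=
    (isClosed_defectSpace hS.dense _).completeSpace_coe
  have hcm : CompleteSpace (defectSpace S (-Complex.I)) :=
    (isClosed_defectSpace hS.dense _).completeSpace_coe
  obtain ⟨J⟩ := hdef.2.nonempty_linearIsometryEquiv hdef.1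
  obtain ⟨T, hT⟩ := exists_boundaryTriplet hc hS J
  have hne : Complex.I - 1 ≠ 0 := fun h => by
    simpa using congrArg Complex.im h
  have hne' : 1 - Complex.I ≠ 0 := by rwa [← neg_sub, neg_ne_zero]
  refine ⟨hc, hS, ⟨m, hm, hdef⟩, defectSpace S Complex.I, inferInstance, inferInstance, hcp, T,
    0, ⟨fun z hz f => ?_, fun z hz f => ?_⟩, fun _ _ _ _ => rfl⟩
  · rw [ho.extensionDomain_eq hc hS (w := Complex.I) (by simpa using hz)]
    obtain ⟨a, b, p, q, hab, hp, hq, hf, hf'⟩ := exists_vonNeumann_I hc hS f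
    have e := (hT f a b ⟨p, hp⟩ ⟨q, hq⟩ hab hf hf').2
    simp only [Pi.zero_apply, zero_apply]
    constructor
    · intro h
      obtain ⟨a', ha', p', hp', hap⟩ := Submodule.mem_sup.1 h
      obtain ⟨b', hab'⟩ := LinearPMap.mem_domain_iff.1 ha'
      have h1 := graph_add_mem (hS.graph_le_adjoint hab') (mem_defectSpace.1 hp')
      rw [hap] at h1
      have h2 := LinearPMap.mem_graph_snd_inj _ (S†.mem_graph f) h1 rfl
      rw [(hT f a' b' ⟨p', hp'⟩ 0 hab' (by simp [hap]) (by simp [h2])).2, map_zero, smul_zero]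
    · intro h
      rw [e, eq_comm, smul_eq_zero, or_iff_right hne', J.map_eq_zero_iff] at h
      have hq0 : q = 0 := congrArg Subtype.val h
      rw [hf, hq0, add_zero]
      exact Submodule.add_mem_sup (LinearPMap.mem_domain_of_mem_graph hab) hp
  · rw [ho.extensionDomain_eq hc hS (w := -Complex.I) (by simpa using hz)]
    obtain ⟨a, b, p, q, hab, hp, hq, hf, hf'⟩ := exists_vonNeumann_I hc hS f
    have e := (hT f a b ⟨p, hp⟩ ⟨q, hq⟩ hab hf hf').1
    simp only [Pi.zero_apply, zero_apply]
    constructor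
    · intro h
      obtain ⟨a', ha', q', hq', haq⟩ := Submodule.mem_sup.1 h
      obtain ⟨b', hab'⟩ := LinearPMap.mem_domain_iff.1 ha'
      have h1 := graph_add_mem (hS.graph_le_adjoint hab') (mem_defectSpace.1 hq')
      rw [haq] at h1
      have h2 := LinearPMap.mem_graph_snd_inj _ (S†.mem_graph f) h1 rfl
      rw [(hT f a' b' 0 ⟨q', hq'⟩ hab' (by simp [haq]) (by simp [h2])).1, smul_zero]
    · intro h
      rw [e, smul_eq_zero, or_iff_right hne] at h
      have hp0 : p = 0 := congrArg Subtype.val h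
      rw [hf, hp0, add_zero]
      exact Submodule.add_mem_sup (LinearPMap.mem_domain_of_mem_graph hab) hq

/-- The characterization of Phillips symmetric operators by orthogonal sums. -/
theorem isPhillips_iff_exists_decomposition (hc : S.IsClosed) (hS : IsSymmetricOp S)
    {m : Cardinal.{0}} (hm : m ≠ 0) (hdef : HasDefectNumbers S m m) :
    IsPhillips S ↔
      ∃ (K₁ K₂ K₃ : Submodule ℂ H)
        (_ : CompleteSpace K₁) (_ : CompleteSpace K₂) (_ : CompleteSpace K₃),
        IsOrthogonalSumOfParts S K₁ K₂ K₃ ∧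
        (IsSimple (part S K₁) ∧ IsMaximalSymmetric (part S K₁) ∧
          HasDefectNumbers (part S K₁) m 0) ∧
        (IsSimple (part S K₂) ∧ IsMaximalSymmetric (part S K₂) ∧
          HasDefectNumbers (part S K₂) 0 m) ∧
        IsSelfAdjoint (part S K₃) := by
  refine ⟨fun h => h.orthogonalDefects.exists_decomposition hc hS hdef, ?_⟩
  rintro ⟨K₁, K₂, K₃, _, _, _, h, ⟨-, hm₁, -, hd₁⟩, ⟨-, hm₂, hd₂, -⟩, h₃⟩
  have : CompleteSpace (defectSpace (part S K₁) (-Complex.I)) :=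
    (isClosed_defectSpace hm₁.symmetric.dense _).completeSpace_coe
  have : CompleteSpace (defectSpace (part S K₂) Complex.I) :=
    (isClosed_defectSpace hm₂.symmetric.dense _).completeSpace_coe
  rw [hasHilbertDim_zero_iff, Submodule.subsingleton_iff_eq_bot] at hd₁ hd₂
  exact (OrthogonalDefects.of_sum hc hS h hd₁ hd₂ h₃).isPhillips hc hS hm hdef

end Triplet

end PhillipsSymmetric

namespace PhillipsSymmetric

open ComplexConjugate Set Filter Topology

/-! ### Fourier uniqueness and integration by parts on half lines -/

section Analysis

variable {N : Type*} [NormedAddCommGroup N] [NormedSpace ℂ N]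

open FourierTransform SchwartzMap in
/-- The Fourier transform is injective on integrable functions. -/
theorem ae_eq_zero_of_integral_exp_smul_eq_zero [CompleteSpace N] {f : ℝ → N} (hf : Integrable f)
    (h : ∀ t : ℝ, ∫ x : ℝ, Complex.exp (t * x * Complex.I) • f x = 0) : f =ᵐ[volume] 0 := by
  have hF : ∀ w, 𝓕 f w = 0 := by
    intro w
    rw [Real.fourier_real_eq_integral_exp_smul, ← h (-2 * Real.pi * w)]
    refine integral_congr_ae (Eventually.of_forall fun x => ?_)
    simp only
    congr 2
    push_cast
    ring
  refine ae_eq_zero_of_integral_contDiff_smul_eq_zero hf.locallyIntegrable fun φ hφ hc => ?_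
  have hφ' : ContDiff ℝ ∞ fun x => (φ x : ℂ) := Complex.ofRealCLM.contDiff.comp hφ
  have hc' : HasCompactSupport fun x => (φ x : ℂ) := hc.comp_left Complex.ofReal_zero
  -- Write the test function as the Fourier transform of a Schwartz function and move that transform
  -- onto f, where it vanishes.
  set ψ : 𝓢(ℝ, ℂ) := hc'.toSchwartzMap hφ' with hψ
  have h1 := VectorFourier.integral_fourierIntegral_smul_eq_flip (L := innerₗ ℝ)
    (μ := volume) (ν := volume) (e := Real.fourierChar) Real.continuous_fourierChar
    continuous_inner (𝓕⁻ ψ).integrable hf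
  have h2 : ∀ x : ℝ, 𝓕 ((𝓕⁻ ψ : 𝓢(ℝ, ℂ)) : ℝ → ℂ) x = φ x := by
    intro x
    have h := FourierTransform.fourier_fourierInv_eq (F := 𝓢(ℝ, ℂ)) ψ
    have h3 := congrArg (fun χ : 𝓢(ℝ, ℂ) => χ x) h
    simp only [fourier_coe] at h3
    exact h3
  have h4 : ∫ x, φ x • f x = ∫ x, 𝓕 ((𝓕⁻ ψ : 𝓢(ℝ, ℂ)) : ℝ → ℂ) x • f x := by
    refine integral_congr_ae (Eventually.of_forall fun x => ?_)
    simp only [h2]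
    exact (Complex.coe_smul _ _).symm
  rw [h4]
  refine h1.trans ?_
  rw [flip_innerₗ]
  have h5 : ∀ x, VectorFourier.fourierIntegral Real.fourierChar volume (innerₗ ℝ) f x = 0 := hF
  simp only [h5, smul_zero, integral_zero]

theorem integrableOn_exp_neg_mul_Ioi {c : ℝ} (hc : 0 < c) :
    IntegrableOn (fun x : ℝ => Real.exp (-c * x)) (Ioi 0) :=
  integrableOn_exp_mul_Ioi (by linarith) 0

theorem integrableOn_exp_smul_of_memLp {g : ℝ → N} (hg : MemLp g 2 volume) {c : ℝ} (hc : 0 < c) :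
    IntegrableOn (fun x => Real.exp (-c * x) • g x) (Ioi 0) := by
  have h1 : MemLp (fun x : ℝ => Real.exp (-c * x)) 2 (volume.restrict (Ioi 0)) := by
    rw [memLp_two_iff_integrable_sq (by fun_prop)]
    refine (integrableOn_exp_neg_mul_Ioi (c := 2 * c) (by linarith)).congr
      (Eventually.of_forall fun x => ?_)
    simp only
    rw [← Real.exp_nat_mul]
    congr 1
    push_cast
    ring
  exact memLp_one_iff_integrable.1 (MemLp.smul (𝕜 := ℝ) (hg.restrict (Ioi 0)) h1)

/-- Integration by parts on the half line against the primitive of `g`. -/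
theorem integral_Ioi_smul_primitive [CompleteSpace N] {g : ℝ → N}
    (hg : ∀ c : ℝ, 0 < c → IntegrableOn (fun x => Real.exp (-c * x) • g x) (Ioi 0))
    {κ κ' : ℝ → ℂ} (hκ : ∀ x, HasDerivAt κ (κ' x) x) (hκ' : Continuous κ')
    {C c : ℝ} (hc : 0 < c) (hb : ∀ x, 0 < x → ‖κ' x‖ ≤ C * Real.exp (-c * x))
    (hlim : Tendsto κ atTop (𝓝 0)) :
    IntegrableOn (fun x => κ' x • ∫ t in (0 : ℝ)..x, g t) (Ioi 0) ∧
      ∫ x in Ioi (0 : ℝ), κ' x • ∫ t in (0 : ℝ)..x, g t = -∫ x in Ioi (0 : ℝ), κ x • g x := by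
  set μ : Measure ℝ := volume.restrict (Ioi 0) with hμ
  -- Fubini on the triangle 0 < t ≤ x: integrating in t gives the primitive of g, integrating κ'
  -- over x ≥ t gives -κ(t).
  set F : ℝ → ℝ → N := fun x t => ({p : ℝ × ℝ | p.2 ≤ p.1}).indicator (fun p => κ' p.1 • g p.2) (x, t)
    with hF
  have hmeas : MeasurableSet {p : ℝ × ℝ | p.2 ≤ p.1} :=
    measurableSet_le measurable_snd measurable_fst
  have hgm : AEStronglyMeasurable g μ := by
    have h1 := (hg 1 one_pos).aestronglyMeasurable
    have h2 : AEStronglyMeasurable (fun x => Real.exp x • Real.exp (-1 * x) • g x) μ :=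
      (by fun_prop : AEStronglyMeasurable (fun x : ℝ => Real.exp x) μ).smul h1
    refine h2.congr (Eventually.of_forall fun y => ?_)
    simp only
    rw [smul_smul, ← Real.exp_add]
    simp
  have hFint : Integrable (Function.uncurry F) (μ.prod μ) := by
    -- For t ≤ x one has e^{-cx} ≤ e^{-cx/2} e^{-ct/2}, so a product of integrable functions
    -- dominates F.
    have hG : Integrable (fun p : ℝ × ℝ => (C * Real.exp (-(c / 2) * p.1)) •
        (Real.exp (-(c / 2) * p.2) • g p.2)) (μ.prod μ) :=
      Integrable.smul_prod ((integrableOn_exp_neg_mul_Ioi (half_pos hc)).const_mul C)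
        (hg _ (half_pos hc))
    refine hG.mono ?_ ?_
    · exact (((hκ'.aestronglyMeasurable (μ := μ)).comp_fst).smul hgm.comp_snd).indicator hmeas
    · have h1 : ∀ᵐ p ∂(μ.prod μ), p.1 ∈ Ioi (0 : ℝ) := by
        have : ∀ᵐ x ∂μ, x ∈ Ioi (0 : ℝ) := ae_restrict_mem measurableSet_Ioi
        exact Measure.quasiMeasurePreserving_fst.ae this
      filter_upwards [h1] with p hp
      change ‖({p : ℝ × ℝ | p.2 ≤ p.1}).indicator (fun p => κ' p.1 • g p.2) p‖ ≤ _
      by_cases hle : p.2 ≤ p.1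
      · rw [indicator_of_mem (by exact hle), norm_smul, norm_smul, norm_smul, ← mul_assoc]
        refine mul_le_mul_of_nonneg_right ?_ (norm_nonneg _)
        have hC : 0 ≤ C := by
          have := (norm_nonneg _).trans (hb p.1 hp)
          exact nonneg_of_mul_nonneg_left this (Real.exp_pos _)
        rw [norm_mul, Real.norm_eq_abs, Real.norm_eq_abs, Real.norm_eq_abs, Real.abs_exp,
          Real.abs_exp, abs_of_nonneg hC, mul_assoc, ← Real.exp_add]
        refine (hb p.1 hp).trans (mul_le_mul_of_nonneg_left ?_ hC)
        rw [Real.exp_le_exp]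
        nlinarith
      · rw [indicator_of_notMem (by exact hle), norm_zero]
        exact norm_nonneg _
  have hx : ∀ x ∈ Ioi (0 : ℝ), ∫ t, F x t ∂μ = κ' x • ∫ t in (0 : ℝ)..x, g t := by
    intro x hx
    have e : (fun t => F x t) = (Iic x).indicator fun t => κ' x • g t := by
      ext t
      by_cases ht : t ≤ x
      · rw [indicator_of_mem (by exact ht)]
        exact indicator_of_mem (by exact ht) _
      · rw [indicator_of_notMem (by exact ht)]
        exact indicator_of_notMem (by exact ht) _
    rw [e, integral_indicator measurableSet_Iic, hμ, Measure.restrict_restrict measurableSet_Iic,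
      inter_comm, Ioi_inter_Iic, integral_smul, intervalIntegral.integral_of_le (le_of_lt hx)]
  have ht : ∀ t ∈ Ioi (0 : ℝ), ∫ x, F x t ∂μ = -(κ t • g t) := by
    intro t ht
    have e : (fun x => F x t) = (Ici t).indicator fun x => κ' x • g t := by
      ext x
      by_cases hx : t ≤ x
      · rw [indicator_of_mem (by exact hx)]
        exact indicator_of_mem (by exact hx) _
      · rw [indicator_of_notMem (by exact hx)]
        exact indicator_of_notMem (by exact hx) _
    have hint : IntegrableOn κ' (Ioi t) := by
      refine Integrable.mono' (((integrableOn_exp_neg_mul_Ioi hc).mono_set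
        (Ioi_subset_Ioi (le_of_lt ht))).const_mul C) hκ'.aestronglyMeasurable ?_
      refine (ae_restrict_iff' measurableSet_Ioi).2 (Eventually.of_forall fun x hx => ?_)
      exact hb x (lt_trans ht hx)
    rw [e, integral_indicator measurableSet_Ici, hμ, Measure.restrict_restrict measurableSet_Ici,
      inter_eq_left.2 (Ici_subset_Ioi.2 ht), integral_Ici_eq_integral_Ioi, integral_smul_const,
      integral_Ioi_of_hasDerivAt_of_tendsto' (fun x _ => hκ x) hint hlim, zero_sub, neg_smul]
  constructor
  · refine hFint.integral_prod_left.congr ?_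
    exact (ae_restrict_iff' measurableSet_Ioi).2 (Eventually.of_forall hx)
  · rw [← setIntegral_congr_fun measurableSet_Ioi hx, integral_integral_swap hFint,
      setIntegral_congr_fun measurableSet_Ioi ht, integral_neg]

theorem integral_Iio_eq_integral_Ioi_comp_neg (f : ℝ → N) :
    ∫ x in Iio (0 : ℝ), f x = ∫ x in Ioi (0 : ℝ), f (-x) := by
  rw [← integral_Iic_eq_integral_Iio, integral_comp_neg_Ioi, neg_zero]

omit [NormedSpace ℂ N] in
theorem integrableOn_Iio_iff_comp_neg {f : ℝ → N} :
    IntegrableOn f (Iio 0) ↔ IntegrableOn (fun x => f (-x)) (Ioi 0) := by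
  have h := (Measure.measurePreserving_neg (volume : Measure ℝ)).integrableOn_comp_preimage
    (Homeomorph.neg ℝ).isClosedEmbedding.measurableEmbedding (f := f) (s := Iio 0)
  rw [← h]
  have e : Neg.neg ⁻¹' Iio (0 : ℝ) = Ioi 0 := by ext; simp
  rw [e]
  rfl

/-- Reflection x ↦ -x reduces to the right half line; the signs from the derivative and from the
reversed primitive cancel. -/
theorem integral_Iio_smul_primitive [CompleteSpace N] {g : ℝ → N}
    (hg : ∀ c : ℝ, 0 < c → IntegrableOn (fun x => Real.exp (-c * x) • g (-x)) (Ioi 0))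
    {κ κ' : ℝ → ℂ} (hκ : ∀ x, HasDerivAt κ (κ' x) x) (hκ' : Continuous κ')
    {C c : ℝ} (hc : 0 < c) (hb : ∀ x, x < 0 → ‖κ' x‖ ≤ C * Real.exp (c * x))
    (hlim : Tendsto κ atBot (𝓝 0)) :
    IntegrableOn (fun x => κ' x • ∫ t in (0 : ℝ)..x, g t) (Iio 0) ∧
      ∫ x in Iio (0 : ℝ), κ' x • ∫ t in (0 : ℝ)..x, g t = -∫ x in Iio (0 : ℝ), κ x • g x := by
  have h := integral_Ioi_smul_primitive hg (κ := fun x => κ (-x)) (κ' := fun x => -κ' (-x))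
    (fun x => by simpa using! (hκ (-x)).scomp x (hasDerivAt_neg x))
    (by fun_prop) (C := C) hc (fun x hx => by
      have := hb (-x) (by linarith)
      rw [norm_neg]
      simpa using this) (hlim.comp tendsto_neg_atTop_atBot)
  have e : ∀ x : ℝ, -κ' (-x) • ∫ t in (0 : ℝ)..x, g (-t) =
      κ' (-x) • ∫ t in (0 : ℝ)..(-x), g t := by
    intro x
    rw [intervalIntegral.integral_comp_neg, neg_zero, intervalIntegral.integral_symm, neg_smul,
      smul_neg, neg_neg]
  simp only [e] at h
  rw [integrableOn_Iio_iff_comp_neg, integral_Iio_eq_integral_Ioi_comp_neg,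
    integral_Iio_eq_integral_Ioi_comp_neg]
  exact h

end Analysis

end PhillipsSymmetric

namespace PhillipsSymmetric

open ComplexConjugate Set Filter Topology

/-! ### Weak derivatives and primitives -/

section WeakDerivative

variable {N : Type*} [NormedAddCommGroup N] [NormedSpace ℂ N] [CompleteSpace N]

omit [CompleteSpace N] in
theorem integral_eq_Iio_add_Ioi {f : ℝ → N} (h : IntegrableOn f (Iio 0))
    (h' : IntegrableOn f (Ioi 0)) : ∫ x, f x = (∫ x in Iio 0, f x) + ∫ x in Ioi 0, f x := by
  rw [← integral_Iic_eq_integral_Iio, ← compl_Iic]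
  rw [← compl_Iic] at h'
  have h1 : IntegrableOn f (Iic 0) := (integrableOn_Iic_iff_integrableOn_Iio).2 h
  have h2 : Integrable f := by
    rw [← integrableOn_univ, ← union_compl_self (Iic (0 : ℝ))]
    exact h1.union h'
  exact (integral_add_compl measurableSet_Iic h2).symm

omit [NormedSpace ℂ N] [CompleteSpace N] in
theorem memLp_comp_neg {g : ℝ → N} (hg : MemLp g 2 volume) :
    MemLp (fun x => g (-x)) 2 volume :=
  hg.comp_measurePreserving (Measure.measurePreserving_neg volume)

/-- Lets test functions meet the exponential decay hypotheses of the half-line formulas. -/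
theorem exists_norm_le_mul_exp {ψ : ℝ → ℂ} (hψ : Continuous ψ) (hc : HasCompactSupport ψ) (c : ℝ) :
    ∃ C, ∀ x, ‖ψ x‖ ≤ C * Real.exp (c * x) := by
  obtain ⟨C, hC⟩ := (hc.mul_left (f := fun x : ℝ => (Real.exp (-(c * x)) : ℂ))).exists_bound_of_continuous
    (by fun_prop)
  refine ⟨C, fun x => ?_⟩
  have h := hC x
  simp only [Pi.mul_apply] at h
  rw [norm_mul, Complex.norm_real, Real.norm_eq_abs, Real.abs_exp, Real.exp_neg] at h
  rwa [inv_mul_le_iff₀ (Real.exp_pos _), mul_comm] at h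

/-- A square integrable function is the weak derivative of its primitive. -/
theorem hasWeakDeriv_primitive {N : Type*} [NormedAddCommGroup N] [InnerProductSpace ℂ N]
    [CompleteSpace N] {g : ℝ → N} (hg : MemLp g 2 volume) :
    HasWeakDeriv (fun x => ∫ t in (0 : ℝ)..x, g t) g := by
  intro φ hφ hc
  have hφ' : Continuous (deriv φ) := hφ.continuous_deriv (by simp)
  have hd : ∀ x, HasDerivAt (fun x => (φ x : ℂ)) ((deriv φ x : ℝ) : ℂ) x := fun x =>
    ((hφ.differentiable (by simp)) x).hasDerivAt.ofReal_comp
  have hcc : HasCompactSupport fun x => ((deriv φ x : ℝ) : ℂ) :=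
    hc.deriv.comp_left Complex.ofReal_zero
  have hccφ : HasCompactSupport fun x => ((φ x : ℝ) : ℂ) := hc.comp_left Complex.ofReal_zero
  have hcont : Continuous fun x => ((deriv φ x : ℝ) : ℂ) := by fun_prop
  have hlim := hccφ
  rw [hasCompactSupport_iff_eventuallyEq, Filter.coclosedCompact_eq_cocompact] at hlim
  obtain ⟨C, hC⟩ := exists_norm_le_mul_exp hcont hcc (-1)
  obtain ⟨C', hC'⟩ := exists_norm_le_mul_exp hcont hcc 1
  obtain ⟨i1, e1⟩ := integral_Ioi_smul_primitive
    (fun c hc => integrableOn_exp_smul_of_memLp hg hc) hd hcont one_pos (fun x _ => hC x)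
    (hlim.filter_mono _root_.atTop_le_cocompact).tendsto
  obtain ⟨i2, e2⟩ := integral_Iio_smul_primitive
    (fun c hc => integrableOn_exp_smul_of_memLp (memLp_comp_neg hg) hc) hd hcont one_pos
    (fun x _ => hC' x) (hlim.filter_mono _root_.atBot_le_cocompact).tendsto
  have hint : Integrable fun x => (φ x : ℂ) • g x := by
    have := (hg.locallyIntegrable one_le_two).integrable_smul_left_of_hasCompactSupport
      (Complex.continuous_ofReal.comp hφ.continuous) hccφ
    exact this
  have h := integral_eq_Iio_add_Ioi i2 i1
  rw [e1, e2, ← neg_add, ← integral_eq_Iio_add_Ioi hint.integrableOn hint.integrableOn] at h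
  simpa only [Complex.coe_smul] using h

/-- The lemma of du Bois-Reymond. -/
theorem exists_ae_eq_const_of_integral_deriv_smul_eq_zero {w : ℝ → N} (hw : LocallyIntegrable w)
    (h : ∀ φ : ℝ → ℝ, ContDiff ℝ ∞ φ → HasCompactSupport φ → ∫ x, deriv φ x • w x = 0) :
    ∃ c : N, w =ᵐ[volume] fun _ => c := by
  set b : ContDiffBump (0 : ℝ) := ⟨1, 2, one_pos, one_lt_two⟩
  set η : ℝ → ℝ := b.normed volume with hη
  have hηd : ContDiff ℝ ∞ η := b.contDiff_normed
  have hηc : HasCompactSupport η := b.hasCompactSupport_normed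
  have hη1 : ∫ x, η x = 1 := b.integral_normed
  have hi : ∀ φ : ℝ → ℝ, Continuous φ → HasCompactSupport φ → Integrable fun x => φ x • w x :=
    fun φ hφ hc => hw.integrable_smul_left_of_hasCompactSupport hφ hc
  refine ⟨∫ x, η x • w x, ?_⟩
  have h0 : ∀ᵐ x, w x - (∫ x, η x • w x) = 0 := by
    refine ae_eq_zero_of_integral_contDiff_smul_eq_zero
      (hw.sub (locallyIntegrable_const _)) fun φ hφ hc => ?_
    have hφi : Integrable φ := hφ.continuous.integrable_of_hasCompactSupport hc
    have hηi : Integrable η := hηd.continuous.integrable_of_hasCompactSupport hηc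
    -- Subtracting a multiple of the unit-mass bump η makes the integral zero, so the primitive Φ of
    -- ψ has compact support and is an admissible test function.
    set ψ : ℝ → ℝ := fun x => φ x - (∫ y, φ y) * η x with hψ
    have hψd : ContDiff ℝ ∞ ψ := hφ.sub (contDiff_const.mul hηd)
    have hψc : HasCompactSupport ψ := hc.sub hηc.mul_left
    have hψi : Integrable ψ := hψd.continuous.integrable_of_hasCompactSupport hψc
    have hψ0 : ∫ x, ψ x = 0 := by
      rw [hψ, integral_sub hφi (hηi.const_mul _), integral_const_mul, hη1, mul_one, sub_self]
    obtain ⟨R, hRpos, hR⟩ : ∃ R : ℝ, 0 < R ∧ ∀ x, R ≤ |x| → ψ x = 0 := by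
      obtain ⟨R, hRpos, hR⟩ := hψc.exists_pos_le_norm
      exact ⟨R, hRpos, hR⟩
    set Φ : ℝ → ℝ := fun x => ∫ t in (-R)..x, ψ t with hΦ
    have hΦ' : ∀ x, HasDerivAt Φ (ψ x) x := fun x =>
      intervalIntegral.integral_hasDerivAt_right (hψi.intervalIntegrable)
        hψd.continuous.stronglyMeasurable.stronglyMeasurableAtFilter hψd.continuous.continuousAt
    have hderiv : deriv Φ = ψ := funext fun x => (hΦ' x).deriv
    have hΦd : ContDiff ℝ ∞ Φ := by
      rw [contDiff_infty_iff_deriv]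
      exact ⟨fun x => (hΦ' x).differentiableAt, hderiv ▸ hψd⟩
    have hΦc : HasCompactSupport Φ := by
      refine HasCompactSupport.of_support_subset_isCompact (isCompact_Icc (a := -R) (b := R)) ?_
      intro x hx
      by_contra hx'
      refine hx ?_
      rw [mem_Icc, not_and_or, not_le, not_le] at hx'
      rcases hx' with hx' | hx'
      · change ∫ t in (-R)..x, ψ t = 0
        rw [intervalIntegral.integral_symm, neg_eq_zero]
        refine intervalIntegral.integral_zero_ae (Eventually.of_forall fun t ht => hR t ?_)
        rw [uIoc_of_le hx'.le] at ht
        rw [abs_of_nonpos (by linarith [ht.2])]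
        linarith [ht.2]
      · change ∫ t in (-R)..x, ψ t = 0
        rw [intervalIntegral.integral_of_le (by linarith), setIntegral_eq_integral_of_forall_compl_eq_zero, hψ0]
        intro t ht
        refine hR t ?_
        rw [mem_Ioc, not_and_or, not_lt, not_le] at ht
        rcases ht with ht | ht
        · rw [abs_of_nonpos (by linarith)]; linarith
        · rw [abs_of_nonneg (by linarith)]; linarith
    have h1 := h Φ hΦd hΦc
    rw [hderiv] at h1
    have hi2 : Integrable fun x => (∫ y, φ y) • η x • w x := (hi η hηd.continuous hηc).smul _
    have h2 : ∫ x, ψ x • w x = (∫ x, φ x • w x) - (∫ y, φ y) • ∫ x, η x • w x := by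
      rw [← integral_smul, ← integral_sub (hi φ hφ.continuous hc) hi2]
      refine integral_congr_ae (Eventually.of_forall fun x => ?_)
      simp only [hψ, sub_smul, mul_smul]
    simp only [smul_sub]
    rw [integral_sub (hi φ hφ.continuous hc) (hφi.smul_const _), integral_smul_const, ← h2, h1]
  filter_upwards [h0] with x hx
  exact sub_eq_zero.1 hx

/-- The continuous representative minus the primitive of g has weak derivative zero, so it is
constant, and it vanishes at 0. Weak derivative and point condition thus merge into one integral
equation. -/
theorem mem_momentumGraph_iff {N : Type*} [NormedAddCommGroup N] [InnerProductSpace ℂ N]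
    [CompleteSpace N] {f p : Lp N 2 (volume : Measure ℝ)} :
    (f, p) ∈ momentumGraph N ↔ ∃ g : Lp N 2 (volume : Measure ℝ), p = Complex.I • g ∧
      f =ᵐ[volume] fun x => ∫ t in (0 : ℝ)..x, g t := by
  have hU : ∀ g : Lp N 2 (volume : Measure ℝ), Continuous fun x => ∫ t in (0 : ℝ)..x, g t :=
    fun g => intervalIntegral.continuous_primitive (fun a b =>
      (((Lp.memLp g).locallyIntegrable one_le_two).integrableOn_isCompact
        isCompact_uIcc).intervalIntegrable) 0
  constructor
  · rintro ⟨⟨g, hg, rfl⟩, u, hu, hfu, hu0⟩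
    refine ⟨g, rfl, hfu.trans ?_⟩
    simp only at hg hfu
    have hwi : LocallyIntegrable (fun x => u x - ∫ t in (0 : ℝ)..x, g t) :=
      (hu.sub (hU g)).locallyIntegrable
    obtain ⟨c, hc⟩ := exists_ae_eq_const_of_integral_deriv_smul_eq_zero hwi fun φ hφ hc => by
      have hφ' : Continuous (deriv φ) := hφ.continuous_deriv (by simp)
      have e1 := hg φ hφ hc
      have e2 := hasWeakDeriv_primitive (Lp.memLp g) φ hφ hc
      have e3 : ∫ x, deriv φ x • f x = ∫ x, deriv φ x • u x :=
        integral_congr_ae (by filter_upwards [hfu] with x hx; rw [hx])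
      simp only [smul_sub]
      rw [integral_sub (hu.locallyIntegrable.integrable_smul_left_of_hasCompactSupport hφ' hc.deriv)
        ((hU g).locallyIntegrable.integrable_smul_left_of_hasCompactSupport hφ' hc.deriv),
        ← e3, e1, e2, sub_self]
    have h1 := (Continuous.ae_eq_iff_eq volume (hu.sub (hU g)) continuous_const).1 hc
    have h2 : u 0 - ∫ t in (0 : ℝ)..0, g t = c := congrFun h1 0
    rw [hu0, intervalIntegral.integral_same, sub_zero] at h2
    refine Eventually.of_forall fun x => ?_
    have h3 : u x - ∫ t in (0 : ℝ)..x, g t = c := congrFun h1 x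
    rw [← h2] at h3
    exact sub_eq_zero.1 h3
  · rintro ⟨g, rfl, hf⟩
    refine ⟨⟨g, fun φ hφ hc => ?_, rfl⟩, _, hU g, hf, intervalIntegral.integral_same⟩
    rw [← hasWeakDeriv_primitive (Lp.memLp g) φ hφ hc]
    exact integral_congr_ae (by filter_upwards [hf] with x hx; rw [hx])

end WeakDerivative

end PhillipsSymmetric

/-! ### Exponentials on half lines and the model operator -/

namespace PhillipsSymmetric

open ComplexConjugate Set Filter Topology

/-- The half line on which `exp (-i z x)` is square integrable. -/
noncomputable def decaySide (z : ℂ) : Set ℝ := if 0 < z.im then Iio 0 else Ioi 0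

theorem measurableSet_decaySide (z : ℂ) : MeasurableSet (decaySide z) := by
  unfold decaySide
  split_ifs
  exacts [measurableSet_Iio, measurableSet_Ioi]

theorem decaySide_of_pos {z : ℂ} (hz : 0 < z.im) : decaySide z = Iio 0 := if_pos hz

theorem decaySide_of_neg {z : ℂ} (hz : z.im < 0) : decaySide z = Ioi 0 := if_neg hz.not_gt

/-- The complex conjugate of `exp (-i z x)`. -/
noncomputable def conjExp (z : ℂ) (x : ℝ) : ℂ := Complex.exp (Complex.I * conj z * x)

theorem conjExp_eq (z : ℂ) (x : ℝ) : conjExp z x = conj (Complex.exp (-Complex.I * z * x)) := by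
  rw [conjExp, ← Complex.exp_conj]
  simp

theorem norm_conjExp (z : ℂ) (x : ℝ) : ‖conjExp z x‖ = Real.exp (z.im * x) := by
  rw [conjExp, Complex.norm_exp]
  simp

@[fun_prop]
theorem continuous_conjExp (z : ℂ) : Continuous (conjExp z) := by
  unfold conjExp
  fun_prop

theorem hasDerivAt_conjExp (z : ℂ) (x : ℝ) :
    HasDerivAt (conjExp z) (Complex.I * conj z * conjExp z x) x := by
  have h1 : HasDerivAt (fun x : ℝ => Complex.I * conj z * (x : ℂ)) (Complex.I * conj z) x := by
    simpa using (Complex.ofRealCLM.hasDerivAt (x := x)).const_mul (Complex.I * conj z)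
  have h2 := h1.cexp
  rw [mul_comm (Complex.exp _)] at h2
  exact h2

section Kernels

variable {N : Type*} [NormedAddCommGroup N] [NormedSpace ℂ N]

theorem integrableOn_conjExp_smul {g : ℝ → N} (hg : MemLp g 2 volume) {z : ℂ} (hz : z.im ≠ 0) :
    IntegrableOn (fun x => conjExp z x • g x) (decaySide z) := by
  have key : ∀ (g : ℝ → N) (e : ℝ → ℂ) (c : ℝ), MemLp g 2 volume → Continuous e → 0 < c →
      (∀ x, ‖e x‖ = Real.exp (-c * x)) → IntegrableOn (fun x => e x • g x) (Ioi 0) := by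
    intro g e c hg he hc hn
    refine Integrable.mono (integrableOn_exp_smul_of_memLp hg hc)
      (he.aestronglyMeasurable.smul hg.1.restrict) (Eventually.of_forall fun x => ?_)
    rw [norm_smul, norm_smul, hn, Real.norm_eq_abs, Real.abs_exp]
  rcases lt_or_gt_of_ne hz with h | h
  · rw [decaySide_of_neg h]
    exact key g _ (-z.im) hg (by fun_prop) (by linarith) fun x => by rw [norm_conjExp]; simp
  · rw [decaySide_of_pos h, integrableOn_Iio_iff_comp_neg]
    exact key _ (fun x => conjExp z (-x)) z.im (memLp_comp_neg hg) (by fun_prop) h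
      fun x => by rw [norm_conjExp]; simp

/-- Integration by parts without boundary terms: the primitive vanishes at 0 and the exponential
decays at infinity. -/
theorem conjExp_smul_primitive [CompleteSpace N] {g : ℝ → N} (hg : MemLp g 2 volume) {z : ℂ}
    (hz : z.im ≠ 0) :
    IntegrableOn (fun x => conjExp z x • ∫ t in (0 : ℝ)..x, g t) (decaySide z) ∧
      conj z • ∫ x in decaySide z, conjExp z x • ∫ t in (0 : ℝ)..x, g t =
        Complex.I • ∫ x in decaySide z, conjExp z x • g x := by
  have hne : Complex.I * conj z ≠ 0 := by
    refine mul_ne_zero Complex.I_ne_zero ((map_ne_zero _).2 ?_)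
    rintro rfl
    exact hz rfl
  have hb : ∀ x, ‖Complex.I * conj z * conjExp z x‖ = ‖z‖ * Real.exp (z.im * x) := fun x => by
    rw [norm_mul, norm_mul, norm_conjExp, Complex.norm_I, one_mul, RCLike.norm_conj]
  have key : IntegrableOn (fun x => (Complex.I * conj z * conjExp z x) • ∫ t in (0 : ℝ)..x, g t)
        (decaySide z) ∧
      ∫ x in decaySide z, (Complex.I * conj z * conjExp z x) • ∫ t in (0 : ℝ)..x, g t =
        -∫ x in decaySide z, conjExp z x • g x := by
    rcases lt_or_gt_of_ne hz with h | h
    · rw [decaySide_of_neg h]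
      refine integral_Ioi_smul_primitive (fun c hc => integrableOn_exp_smul_of_memLp hg hc)
        (hasDerivAt_conjExp z) (by fun_prop) (C := ‖z‖) (c := -z.im) (by linarith)
        (fun x _ => by rw [hb, neg_neg]) ?_
      rw [tendsto_zero_iff_norm_tendsto_zero]
      simp only [norm_conjExp]
      exact Real.tendsto_exp_atBot.comp (tendsto_id.const_mul_atTop_of_neg h)
    · rw [decaySide_of_pos h]
      refine integral_Iio_smul_primitive
        (fun c hc => integrableOn_exp_smul_of_memLp (memLp_comp_neg hg) hc)
        (hasDerivAt_conjExp z) (by fun_prop) (C := ‖z‖) (c := z.im) h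
        (fun x _ => by rw [hb]) ?_
      rw [tendsto_zero_iff_norm_tendsto_zero]
      simp only [norm_conjExp]
      exact Real.tendsto_exp_atBot.comp (tendsto_id.const_mul_atBot h)
  simp only [mul_smul (Complex.I * conj z)] at key
  obtain ⟨h1, h2⟩ := key
  refine ⟨(integrable_fun_smul_iff hne _).1 h1, ?_⟩
  rw [integral_smul] at h2
  have h3 := congrArg (fun v => (-Complex.I) • v) h2
  simp only [smul_smul, smul_neg, neg_smul, neg_neg] at h3
  rw [← h3]
  congr 1
  linear_combination (conj z) * Complex.I_mul_I

/-- The functions `exp (-i z x)` on the two half lines are total. -/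
theorem ae_eq_zero_of_integral_conjExp_smul_eq_zero [CompleteSpace N] {w : ℝ → N}
    (hi : ∀ z : ℂ, z.im ≠ 0 → IntegrableOn (fun x => conjExp z x • w x) (decaySide z))
    (h : ∀ z : ℂ, z.im ≠ 0 → ∫ x in decaySide z, conjExp z x • w x = 0) : w =ᵐ[volume] 0 := by
  have key : ∀ z : ℂ, z.im ≠ 0 → ∀ᵐ x, x ∈ decaySide z → w x = 0 := by
    intro z hz
    -- A real shift of z keeps the half line and multiplies the exponential by e^{itx}, so the
    -- hypothesis kills a whole Fourier transform.
    have hside : ∀ t : ℝ, decaySide (z + t) = decaySide z := fun t => by simp [decaySide]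
    have hmul : ∀ t x : ℝ, conjExp (z + t) x = Complex.exp (t * x * Complex.I) * conjExp z x := by
      intro t x
      rw [conjExp, conjExp, ← Complex.exp_add]
      congr 1
      simp
      ring
    have h1 := ae_eq_zero_of_integral_exp_smul_eq_zero
      ((hi z hz).integrable_indicator (measurableSet_decaySide z)) fun t => by
        have h2 := h (z + t) (by simpa using hz)
        rw [hside, ← integral_indicator (measurableSet_decaySide z)] at h2
        rw [← h2]
        refine integral_congr_ae (Eventually.of_forall fun x => ?_)
        by_cases hx : x ∈ decaySide z
        · simp only [indicator_of_mem hx, hmul, mul_smul]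
        · simp only [indicator_of_notMem hx, smul_zero]
    filter_upwards [h1] with x hx hxs
    rw [indicator_of_mem hxs] at hx
    exact (smul_eq_zero.1 hx).resolve_left (Complex.exp_ne_zero _)
  have hne : ∀ᵐ x : ℝ, x ≠ 0 := by simp [ae_iff]
  filter_upwards [key Complex.I (by simp), key (-Complex.I) (by simp), hne] with x h1 h2 hx
  rw [decaySide_of_pos (by simp)] at h1
  rw [decaySide_of_neg (by simp)] at h2
  rcases lt_or_gt_of_ne hx with h | h
  exacts [h1 h, h2 h]

/-- By parts, the pairing equals z̄ times that of the exponential with the primitive minus f;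
totality of the exponentials concludes. -/
theorem ae_eq_primitive_iff [CompleteSpace N] {f g : ℝ → N} (hf : MemLp f 2 volume)
    (hg : MemLp g 2 volume) :
    (f =ᵐ[volume] fun x => ∫ t in (0 : ℝ)..x, g t) ↔
      ∀ z : ℂ, z.im ≠ 0 →
        ∫ x in decaySide z, conjExp z x • (Complex.I • g x - conj z • f x) = 0 := by
  have key : ∀ z : ℂ, z.im ≠ 0 →
      ∫ x in decaySide z, conjExp z x • (Complex.I • g x - conj z • f x) =
        conj z • ∫ x in decaySide z, conjExp z x • ((∫ t in (0 : ℝ)..x, g t) - f x) := by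
    intro z hz
    obtain ⟨h1, h2⟩ := conjExp_smul_primitive hg hz
    have h3 := integrableOn_conjExp_smul hf hz
    have h4 := integrableOn_conjExp_smul hg hz
    have h3' : IntegrableOn (fun x => conj z • conjExp z x • f x) (decaySide z) := h3.smul _
    have h4' : IntegrableOn (fun x => Complex.I • conjExp z x • g x) (decaySide z) := h4.smul _
    simp only [smul_sub, smul_comm (conjExp z _) (_ : ℂ)]
    rw [integral_sub h4' h3', integral_sub h1 h3, smul_sub, h2, integral_smul, integral_smul]
  constructor
  · intro h z hz
    rw [key z hz]
    have : ∫ x in decaySide z, conjExp z x • ((∫ t in (0 : ℝ)..x, g t) - f x) = 0 := by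
      refine integral_eq_zero_of_ae (ae_restrict_of_ae ?_)
      filter_upwards [h] with x hx
      simp [hx]
    rw [this, smul_zero]
  · intro h
    have h0 := ae_eq_zero_of_integral_conjExp_smul_eq_zero
      (w := fun x => (∫ t in (0 : ℝ)..x, g t) - f x) (fun z hz => by
        simp only [smul_sub]
        exact (conjExp_smul_primitive hg hz).1.sub (integrableOn_conjExp_smul hf hz)) fun z hz => by
        have h1 := h z hz
        rw [key z hz] at h1
        refine (smul_eq_zero.1 h1).resolve_left ((map_ne_zero _).2 ?_)
        rintro rfl
        exact hz rfl
    filter_upwards [h0] with x hx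
    exact (sub_eq_zero.1 hx).symm

end Kernels

section Model

variable {N : Type*} [NormedAddCommGroup N] [InnerProductSpace ℂ N]

/-- The factor √2 makes n ↦ √2 e^{-izx}n isometric at z = ±i. -/
theorem memLp_modelVector {z : ℂ} (hz : z.im ≠ 0) (n : N) :
    MemLp (fun x : ℝ => (decaySide z).indicator
      (fun x : ℝ => (Real.sqrt 2 * Complex.exp (-Complex.I * z * x)) • n) x) 2 volume := by
  rw [memLp_indicator_iff_restrict (measurableSet_decaySide z),
    memLp_two_iff_integrable_sq_norm (by fun_prop)]
  have h : ∀ x : ℝ, ‖(Real.sqrt 2 * Complex.exp (-Complex.I * z * x)) • n‖ ^ 2 =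
      2 * ‖n‖ ^ 2 * Real.exp (2 * z.im * x) := by
    intro x
    have e : ‖Complex.exp (-Complex.I * z * x)‖ = Real.exp (z.im * x) := by
      rw [← norm_conjExp, conjExp_eq, RCLike.norm_conj]
    rw [norm_smul, norm_mul, e, Complex.norm_real, Real.norm_eq_abs, mul_pow, mul_pow, sq_abs,
      Real.sq_sqrt zero_le_two, ← Real.exp_nat_mul]
    push_cast
    ring_nf
  simp only [h]
  refine Integrable.const_mul ?_ _
  rcases lt_or_gt_of_ne hz with h | h
  · rw [decaySide_of_neg h]
    exact integrableOn_exp_mul_Ioi (by linarith) 0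
  · rw [decaySide_of_pos h]
    exact (integrableOn_exp_mul_Iic (by linarith) 0).mono_set Iio_subset_Iic_self

/-- The normalized elements `√2 exp (-i z x) n` of the defect subspaces of the model operator. -/
noncomputable def modelVector {z : ℂ} (hz : z.im ≠ 0) (n : N) : Lp N 2 (volume : Measure ℝ) :=
  (memLp_modelVector hz n).toLp _

variable [CompleteSpace N]

theorem inner_modelVector {z : ℂ} (hz : z.im ≠ 0) (n : N) (h : Lp N 2 (volume : Measure ℝ)) :
    inner ℂ (modelVector hz n) h =
      Real.sqrt 2 * inner ℂ n (∫ x in decaySide z, conjExp z x • h x) := by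
  rw [L2.inner_def, ← integral_inner (integrableOn_conjExp_smul (Lp.memLp h) hz),
    ← integral_const_mul, ← integral_indicator (measurableSet_decaySide z)]
  refine integral_congr_ae ?_
  filter_upwards [(memLp_modelVector hz n).coeFn_toLp] with x hx
  rw [modelVector, hx]
  by_cases hxs : x ∈ decaySide z
  · rw [indicator_of_mem hxs, indicator_of_mem hxs, inner_smul_left, inner_smul_right, map_mul,
      conjExp_eq, Complex.conj_ofReal, mul_assoc]
  · rw [indicator_of_notMem hxs, indicator_of_notMem hxs, inner_zero_left]

theorem inner_modelVector_of_decaySide_eq {z z' : ℂ} (hz : z.im ≠ 0) (hz' : z'.im ≠ 0) (n n' : N)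
    (hs : decaySide z' = decaySide z) :
    inner ℂ (modelVector hz' n') (modelVector hz n) =
      2 * (∫ x : ℝ in decaySide z, Complex.exp (Complex.I * (conj z' - z) * x)) * inner ℂ n' n := by
  have e : ∫ x in decaySide z, conjExp z' x • modelVector hz n x =
      (Real.sqrt 2 * ∫ x : ℝ in decaySide z, Complex.exp (Complex.I * (conj z' - z) * x)) • n := by
    rw [← integral_const_mul, ← integral_smul_const]
    refine setIntegral_congr_ae (measurableSet_decaySide z) ?_
    filter_upwards [(memLp_modelVector hz n).coeFn_toLp] with x hx hxs
    rw [modelVector, hx, indicator_of_mem hxs, smul_smul, mul_left_comm, conjExp, ← Complex.exp_add]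
    congr 3
    ring
  rw [inner_modelVector, hs, e, inner_smul_right, ← mul_assoc, ← mul_assoc, ← Complex.ofReal_mul,
    Real.mul_self_sqrt zero_le_two, Complex.ofReal_ofNat]

/-- With a = i(z̄' - z), the integral of e^{ax} over x < 0 is 1/a, and z - z̄' = ia. The result has
the form that Green's identity gives in `exists_model_family`. -/
theorem inner_modelVector_of_pos {z z' : ℂ} (hz : 0 < z.im) (hz' : 0 < z'.im) (n n' : N) :
    inner ℂ (modelVector hz'.ne' n') (modelVector hz.ne' n) * (z - conj z') =
      2 * Complex.I * inner ℂ n' n := by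
  have hre : 0 < (Complex.I * (conj z' - z)).re := by
    simp
    linarith
  have hne : Complex.I * (conj z' - z) ≠ 0 := fun h => by simp [h] at hre
  rw [inner_modelVector_of_decaySide_eq _ _ _ _ (by rw [decaySide_of_pos hz, decaySide_of_pos hz']),
    decaySide_of_pos hz, ← integral_Iic_eq_integral_Iio, integral_exp_mul_complex_Iic hre]
  have e : z - conj z' = Complex.I * (Complex.I * (conj z' - z)) := by
    linear_combination -(conj z' - z) * Complex.I_mul_I
  rw [e]
  simp only [Complex.ofReal_zero, mul_zero, Complex.exp_zero]
  generalize Complex.I * (conj z' - z) = a at hne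
  field_simp

theorem inner_modelVector_of_neg {z z' : ℂ} (hz : z.im < 0) (hz' : z'.im < 0) (n n' : N) :
    inner ℂ (modelVector hz'.ne n') (modelVector hz.ne n) * (z - conj z') =
      -(2 * Complex.I * inner ℂ n' n) := by
  have hre : (Complex.I * (conj z' - z)).re < 0 := by
    simp
    linarith
  have hne : Complex.I * (conj z' - z) ≠ 0 := fun h => by simp [h] at hre
  rw [inner_modelVector_of_decaySide_eq _ _ _ _ (by rw [decaySide_of_neg hz, decaySide_of_neg hz']),
    decaySide_of_neg hz, integral_exp_mul_complex_Ioi hre]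
  have e : z - conj z' = Complex.I * (Complex.I * (conj z' - z)) := by
    linear_combination -(conj z' - z) * Complex.I_mul_I
  rw [e]
  simp only [Complex.ofReal_zero, mul_zero, Complex.exp_zero]
  generalize Complex.I * (conj z' - z) = a at hne
  field_simp

theorem inner_modelVector_of_disjoint {z z' : ℂ} (hz : z.im ≠ 0) (hz' : z'.im ≠ 0) (n n' : N)
    (hs : Disjoint (decaySide z') (decaySide z)) :
    inner ℂ (modelVector hz' n') (modelVector hz n) = 0 := by
  have e : ∫ x in decaySide z', conjExp z' x • modelVector hz n x = 0 := by
    refine (setIntegral_congr_ae (measurableSet_decaySide z') ?_).trans (integral_zero _ _)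
    filter_upwards [(memLp_modelVector hz n).coeFn_toLp] with x hx hxs
    rw [modelVector, hx, indicator_of_notMem (hs.notMem_of_mem_left hxs), smul_zero]
  rw [inner_modelVector, e, inner_zero_right, mul_zero]

theorem eq_zero_of_inner_modelVector_eq_zero {h : Lp N 2 (volume : Measure ℝ)}
    (hh : ∀ (z : ℂ) (hz : z.im ≠ 0) (n : N), inner ℂ (modelVector hz n) h = 0) : h = 0 := by
  refine Lp.ext ((ae_eq_zero_of_integral_conjExp_smul_eq_zero
    (fun z hz => integrableOn_conjExp_smul (Lp.memLp h) hz) fun z hz => ?_).trans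
      (Lp.coeFn_zero _ _ _).symm)
  -- Testing with n equal to the vector-valued integral itself makes its norm vanish.
  have h1 := hh z hz (∫ x in decaySide z, conjExp z x • h x)
  rw [inner_modelVector] at h1
  exact inner_self_eq_zero.1 ((mul_eq_zero.1 h1).resolve_left (by simp))

/-- The analogue of `mem_graph_iff_of_residual_eq_bot` for the model, obtained without computing the
adjoint of `momentum`. -/
theorem mem_graph_momentum_iff {f p : Lp N 2 (volume : Measure ℝ)} :
    (f, p) ∈ (momentum N).graph ↔
      ∀ (z : ℂ) (hz : z.im ≠ 0) (n : N), inner ℂ (modelVector hz n) (p - conj z • f) = 0 := by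
  have hp : p = Complex.I • ((-Complex.I) • p) := by rw [smul_smul]; simp
  rw [graph_momentum, mem_momentumGraph_iff]
  have h1 : (∃ g : Lp N 2 (volume : Measure ℝ), p = Complex.I • g ∧
      f =ᵐ[volume] fun x => ∫ t in (0 : ℝ)..x, g t) ↔
      f =ᵐ[volume] fun x => ∫ t in (0 : ℝ)..x, ((-Complex.I) • p : Lp N 2 (volume : Measure ℝ)) t := by
    constructor
    · rintro ⟨g, hg, h⟩
      have : (-Complex.I) • p = g := by rw [hg, smul_smul]; simp
      rwa [this]
    · exact fun h => ⟨_, hp, h⟩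
  rw [h1, ae_eq_primitive_iff (Lp.memLp _) (Lp.memLp _)]
  refine forall_congr' fun z => forall_congr' fun hz => ?_
  have h2 : ∫ x in decaySide z, conjExp z x •
        (Complex.I • ((-Complex.I) • p : Lp N 2 (volume : Measure ℝ)) x - conj z • f x) =
      ∫ x in decaySide z, conjExp z x • (p - conj z • f : Lp N 2 (volume : Measure ℝ)) x := by
    refine integral_congr_ae (ae_restrict_of_ae ?_)
    filter_upwards [Lp.coeFn_sub p (conj z • f), Lp.coeFn_smul (conj z) f,
      Lp.coeFn_smul (-Complex.I) p] with x e1 e2 e3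
    rw [e1, Pi.sub_apply, e2, e3, Pi.smul_apply, Pi.smul_apply, smul_smul]
    simp
  rw [h2]
  constructor
  · intro h n
    rw [inner_modelVector, h, inner_zero_right, mul_zero]
  · intro h
    have h3 := h (∫ x in decaySide z, conjExp z x • (p - conj z • f : Lp N 2 (volume : Measure ℝ)) x)
    rw [inner_modelVector] at h3
    exact inner_self_eq_zero.1 ((mul_eq_zero.1 h3).resolve_left (by simp))

end Model

end PhillipsSymmetric

namespace PhillipsSymmetric

open ComplexConjugate

/-! ### Unitaries from Gram matrices -/

section Gram

variable {ι E F : Type*} [NormedAddCommGroup E] [InnerProductSpace ℂ E] [CompleteSpace E]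
  [NormedAddCommGroup F] [InnerProductSpace ℂ F] [CompleteSpace F]

/-- Two total families with the same Gram matrix are related by a unitary operator. -/
theorem exists_linearIsometryEquiv_of_gram_eq (a : ι → E) (b : ι → F)
    (h : ∀ i j, inner ℂ (a i) (a j) = inner ℂ (b i) (b j))
    (ha : (Submodule.span ℂ (Set.range a))ᗮ = ⊥) (hb : (Submodule.span ℂ (Set.range b))ᗮ = ⊥) :
    ∃ U : E ≃ₗᵢ[ℂ] F, ∀ i, U (a i) = b i := by
  set A := Finsupp.linearCombination ℂ a with hA
  set B := Finsupp.linearCombination ℂ b with hB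
  have hin : ∀ f g : ι →₀ ℂ, inner ℂ (A f) (A g) = inner ℂ (B f) (B g) := by
    intro f g
    simp only [hA, hB, Finsupp.linearCombination_apply, Finsupp.sum_inner, Finsupp.inner_sum,
      inner_smul_left, inner_smul_right, h]
  have hn : ∀ f, ‖B f‖ = ‖A f‖ := by
    intro f
    rw [@norm_eq_sqrt_re_inner ℂ, @norm_eq_sqrt_re_inner ℂ, hin]
  have hdA : DenseRange A := by
    rw [DenseRange, ← LinearMap.coe_range, hA, Finsupp.range_linearCombination]
    exact (Submodule.dense_iff_topologicalClosure_eq_top).2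
      (Submodule.topologicalClosure_eq_top_iff.2 ha)
  have hdB : DenseRange B := by
    rw [DenseRange, ← LinearMap.coe_range, hB, Finsupp.range_linearCombination]
    exact (Submodule.dense_iff_topologicalClosure_eq_top).2
      (Submodule.topologicalClosure_eq_top_iff.2 hb)
  set U := (LinearEquiv.refl ℂ (ι →₀ ℂ)).extendOfIsometry A B hdA hdB hn
  refine ⟨U, fun i => ?_⟩
  have h1 := LinearEquiv.extendOfIsometry_eq (LinearEquiv.refl ℂ (ι →₀ ℂ)) A B hdA hdB hn
    (Finsupp.single i 1)
  simpa [hA, hB] using h1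

end Gram

/-! ### Unitary equivalence with the model -/

section Unitary

variable {H : Type*} [NormedAddCommGroup H] [InnerProductSpace ℂ H] [CompleteSpace H]
  {S : H →ₗ.[ℂ] H}

/-- Solving (S + i)s = y + ix gives s ∈ D(S) with x - s residual, hence x = s. -/
theorem mem_graph_iff_of_residual_eq_bot (ho : OrthogonalDefects S) (hc : S.IsClosed)
    (hS : IsSymmetricOp S) (hr : residual S = ⊥) {x y : H} :
    (x, y) ∈ S.graph ↔
      ∀ z : ℂ, z.im ≠ 0 → ∀ n ∈ defectSpace S z, inner ℂ n (y - conj z • x) = 0 := by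
  refine ⟨fun h z _ n hn => inner_defect' hS.dense hn h, fun h => ?_⟩
  have hI : (Complex.I).im ≠ 0 := by simp
  obtain ⟨s, s', hs, he⟩ := mem_rangeSub.1 (mem_rangeSub_of_orthogonal hc hS hI
    (v := y - conj Complex.I • x) (h _ hI))
  have hys : y - s' = conj Complex.I • (x - s) := by
    rw [smul_sub, sub_eq_sub_iff_sub_eq_sub, ← he]
  have hres : x - s ∈ residual S := by
    refine ho.mem_residual_of_forall_ne hc hS (z₀ := Complex.I) fun z hz hne n hn => ?_
    have h2 : inner ℂ n ((y - s') - conj z • (x - s)) = 0 := by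
      have e : (y - s') - conj z • (x - s) = (y - conj z • x) - (s' - conj z • s) := by module
      rw [e, inner_sub_right, h z hz n hn, inner_defect' hS.dense hn hs, sub_zero]
    rw [hys, ← sub_smul, inner_smul_right, ← map_sub] at h2
    exact (mul_eq_zero.1 h2).resolve_left ((map_ne_zero _).2 (sub_ne_zero.2 hne.symm))
  rw [hr, Submodule.mem_bot] at hres
  rw [hres, smul_zero, sub_eq_zero] at hys
  rw [sub_eq_zero] at hres
  rwa [hres, hys]

/-- The inner product of two defect elements is determined by their boundary values. -/
theorem inner_mul_sub_eq (hS : IsSymmetricOp S) {z z' w : ℂ} {f f' p p' : H}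
    (hf : f ∈ defectSpace S z) (hf' : f' ∈ defectSpace S z') (hp : p ∈ defectSpace S w)
    (hp' : p' ∈ defectSpace S w) (h : f - p ∈ S.domain) (h' : f' - p' ∈ S.domain) :
    inner ℂ f' f * (z - conj z') = inner ℂ p' p * (w - conj w) := by
  obtain ⟨b, hb⟩ := LinearPMap.mem_domain_iff.1 h
  obtain ⟨b', hb'⟩ := LinearPMap.mem_domain_iff.1 h'
  -- Since f and p agree modulo D(S), as do f' and p', the boundary form takes the same value on
  -- both pairs; the eigenvalue equations evaluate it.
  have h1 := boundaryForm_eq hS.dense (mem_defectSpace.1 hp) (mem_defectSpace.1 hp') hb hb' hS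
  have e := LinearPMap.mem_graph_snd_inj _ (mem_defectSpace.1 hf)
    (graph_add_mem (mem_defectSpace.1 hp) (hS.graph_le_adjoint hb)) (by simp)
  have e' := LinearPMap.mem_graph_snd_inj _ (mem_defectSpace.1 hf')
    (graph_add_mem (mem_defectSpace.1 hp') (hS.graph_le_adjoint hb')) (by simp)
  rw [← e, ← e', add_sub_cancel, add_sub_cancel] at h1
  simp only [inner_smul_left, inner_smul_right] at h1
  linear_combination h1

variable {N : Type*} [NormedAddCommGroup N] [InnerProductSpace ℂ N]

/-- Elements of `ker (S* - z)` with prescribed boundary values in `ker (S* - w)`. -/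
theorem OrthogonalDefects.exists_defect_param (ho : OrthogonalDefects S) (hc : S.IsClosed)
    (hS : IsSymmetricOp S) {w z : ℂ} (hwz : 0 < w.im * z.im) (J : N ≃ₗᵢ[ℂ] defectSpace S w) :
    ∃ a : N → H, (∀ n, a n ∈ defectSpace S z ∧ a n - J n ∈ S.domain) ∧
      ∀ f ∈ defectSpace S z, ∃ n, a n = f := by
  have key : ∀ n, ∃ f, f ∈ defectSpace S z ∧ f - J n ∈ S.domain := by
    intro n
    obtain ⟨s, hs, f, hf, e⟩ := Submodule.mem_sup.1
      (ho.mem_extensionDomain hc hS (by rwa [mul_comm]) (J n).2)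
    refine ⟨f, hf, ?_⟩
    rw [← e, sub_add_cancel_right]
    exact S.domain.neg_mem hs
  choose a ha using key
  refine ⟨a, ha, fun f hf => ?_⟩
  obtain ⟨s, hs, p, hp, e⟩ := Submodule.mem_sup.1 (ho.mem_extensionDomain hc hS hwz hf)
  refine ⟨J.symm ⟨p, hp⟩, ?_⟩
  obtain ⟨h1, h2⟩ := ha (J.symm ⟨p, hp⟩)
  rw [J.apply_symm_apply] at h2
  -- The difference of `a n` and f lies in D(S) ∩ N_z, which is zero because S has no nonreal
  -- eigenvalues.
  have h3 := S.domain.sub_mem h2 hs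
  rw [sub_sub, add_comm p, e] at h3
  obtain ⟨b, hb⟩ := LinearPMap.mem_domain_iff.1 h3
  have e2 := LinearPMap.mem_graph_snd_inj _ (hS.graph_le_adjoint hb)
    (mem_defectSpace.1 (Submodule.sub_mem _ h1 hf)) rfl
  rw [e2] at hb
  refine sub_eq_zero.1 (hS.eq_zero_of_eigen (z := z) ?_ hb)
  rintro h0
  simp [h0] at hwz

theorem OrthogonalDefects.exists_model_family (ho : OrthogonalDefects S) (hc : S.IsClosed)
    (hS : IsSymmetricOp S) (Jp : N ≃ₗᵢ[ℂ] defectSpace S Complex.I)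
    (Jm : N ≃ₗᵢ[ℂ] defectSpace S (-Complex.I)) :
    ∃ a : {z : ℂ // z.im ≠ 0} → N → H, (∀ (z : {z : ℂ // z.im ≠ 0}) n, a z n ∈ defectSpace S z) ∧
      (∀ z : {z : ℂ // z.im ≠ 0}, ∀ f ∈ defectSpace S (z : ℂ), ∃ n, a z n = f) ∧
      (∀ z z' : {z : ℂ // z.im ≠ 0}, 0 < z.1.im → 0 < z'.1.im → ∀ n n',
        inner ℂ (a z' n') (a z n) * (z - conj (z' : ℂ)) = 2 * Complex.I * inner ℂ n' n) ∧
      (∀ z z' : {z : ℂ // z.im ≠ 0}, z.1.im < 0 → z'.1.im < 0 → ∀ n n',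
        inner ℂ (a z' n') (a z n) * (z - conj (z' : ℂ)) = -(2 * Complex.I * inner ℂ n' n)) := by
  have key : ∀ z : {z : ℂ // z.im ≠ 0}, ∃ a : N → H,
      (∀ n, a n ∈ defectSpace S z) ∧ (∀ f ∈ defectSpace S (z : ℂ), ∃ n, a n = f) ∧
      (0 < z.1.im → ∀ n, a n - Jp n ∈ S.domain) ∧ (z.1.im < 0 → ∀ n, a n - Jm n ∈ S.domain) := by
    rintro ⟨z, hz⟩
    rcases lt_or_gt_of_ne hz with h | h
    · obtain ⟨a, h1, h2⟩ := ho.exists_defect_param hc hS (z := z) (by simpa using h) Jm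
      exact ⟨a, fun n => (h1 n).1, h2, fun h' => absurd h' h.not_gt, fun _ n => (h1 n).2⟩
    · obtain ⟨a, h1, h2⟩ := ho.exists_defect_param hc hS (z := z) (by simpa using h) Jp
      exact ⟨a, fun n => (h1 n).1, h2, fun _ n => (h1 n).2, fun h' => absurd h' h.not_gt⟩
  choose a h1 h2 h3 h4 using key
  refine ⟨a, h1, h2, fun z z' hz hz' n n' => ?_, fun z z' hz hz' n n' => ?_⟩
  · rw [inner_mul_sub_eq hS (h1 z n) (h1 z' n') (Jp n).2 (Jp n').2 (h3 z hz n) (h3 z' hz' n'),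
      ← Submodule.coe_inner, Jp.inner_map_map, Complex.conj_I]
    ring
  · rw [inner_mul_sub_eq hS (h1 z n) (h1 z' n') (Jm n).2 (Jm n').2 (h4 z hz n) (h4 z' hz' n'),
      ← Submodule.coe_inner, Jm.inner_map_map, map_neg, Complex.conj_I]
    ring

theorem sub_conj_ne_zero {z z' : ℂ} (h : 0 < z.im * z'.im) : z - conj z' ≠ 0 := by
  intro h0
  have := congrArg Complex.im h0
  simp only [Complex.sub_im, Complex.conj_im, Complex.zero_im] at this
  have h1 : z.im = -z'.im := by linarith
  rw [h1] at h
  nlinarith [mul_self_nonneg z'.im]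

/-- Within a half plane z - z̄' ≠ 0 can be cancelled. Across half planes both sides vanish, by
orthogonality of the defects and by disjointness of supports. -/
theorem OrthogonalDefects.exists_family_gram_eq [CompleteSpace N] (ho : OrthogonalDefects S)
    (hc : S.IsClosed) (hS : IsSymmetricOp S) (Jp : N ≃ₗᵢ[ℂ] defectSpace S Complex.I)
    (Jm : N ≃ₗᵢ[ℂ] defectSpace S (-Complex.I)) :
    ∃ a : {z : ℂ // z.im ≠ 0} → N → H, (∀ (z : {z : ℂ // z.im ≠ 0}) n, a z n ∈ defectSpace S z) ∧
      (∀ z : {z : ℂ // z.im ≠ 0}, ∀ f ∈ defectSpace S (z : ℂ), ∃ n, a z n = f) ∧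
      ∀ (z' z : {z : ℂ // z.im ≠ 0}) (n' n : N), inner ℂ (a z' n') (a z n) =
        inner ℂ (modelVector z'.2 n') (modelVector z.2 n) := by
  obtain ⟨a, hmem, hsurj, hpos, hneg⟩ := ho.exists_model_family hc hS Jp Jm
  refine ⟨a, hmem, hsurj, ?_⟩
  intro z' z n' n
  rcases lt_or_gt_of_ne z.2 with h | h <;> rcases lt_or_gt_of_ne z'.2 with h' | h'
  · refine mul_right_cancel₀ (sub_conj_ne_zero (mul_pos_of_neg_of_neg h h')) ?_
    exact (hneg z z' h h' n n').trans (inner_modelVector_of_neg h h' n n').symm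
  · rw [ho.inner_eq_zero (mul_neg_of_pos_of_neg h' h) (hmem z' n') (hmem z n),
      inner_modelVector_of_disjoint z.2 z'.2 n n']
    rw [decaySide_of_neg h, decaySide_of_pos h']
    exact Set.disjoint_left.2 fun x h1 h2 => lt_asymm (Set.mem_Iio.1 h1) (Set.mem_Ioi.1 h2)
  · rw [ho.inner_eq_zero (mul_neg_of_neg_of_pos h' h) (hmem z' n') (hmem z n),
      inner_modelVector_of_disjoint z.2 z'.2 n n']
    rw [decaySide_of_pos h, decaySide_of_neg h']
    exact Set.disjoint_left.2 fun x h1 h2 => lt_asymm (Set.mem_Ioi.1 h1) (Set.mem_Iio.1 h2)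
  · refine mul_right_cancel₀ (sub_conj_ne_zero (mul_pos h h')) ?_
    exact (hpos z z' h h' n n').trans (inner_modelVector_of_pos h h' n n').symm

/-- The unitary carries defect vectors to model vectors, and both graphs are cut out by the same
orthogonality conditions against these families. -/
theorem OrthogonalDefects.unitarilyEquivalent_momentum [CompleteSpace N]
    (ho : OrthogonalDefects S) (hc : S.IsClosed) (hS : IsSymmetricOp S) (hr : residual S = ⊥)
    (Jp : N ≃ₗᵢ[ℂ] defectSpace S Complex.I) (Jm : N ≃ₗᵢ[ℂ] defectSpace S (-Complex.I)) :
    UnitarilyEquivalent S (momentum N) := by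
  obtain ⟨a, hmem, hsurj, hgram⟩ := ho.exists_family_gram_eq hc hS Jp Jm
  obtain ⟨U, hU⟩ := exists_linearIsometryEquiv_of_gram_eq
    (fun i : {z : ℂ // z.im ≠ 0} × N => a i.1 i.2) (fun i => modelVector i.1.2 i.2)
    (fun i j => hgram i.1 j.1 i.2 j.2)
    (by
      rw [eq_bot_iff, ← hr]
      intro v hv
      rw [mem_residual]
      intro z hz n hn
      obtain ⟨k, rfl⟩ := hsurj ⟨z, hz⟩ n hn
      exact hv _ (Submodule.subset_span ⟨(⟨z, hz⟩, k), rfl⟩))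
    (by
      rw [eq_bot_iff]
      intro v hv
      exact eq_zero_of_inner_modelVector_eq_zero fun z hz n =>
        hv _ (Submodule.subset_span ⟨(⟨z, hz⟩, n), rfl⟩))
  refine ⟨U, fun x y => ?_⟩
  rw [mem_graph_iff_of_residual_eq_bot ho hc hS hr, mem_graph_momentum_iff]
  refine forall_congr' fun z => forall_congr' fun hz => ?_
  have hin : ∀ n, inner ℂ (modelVector hz n) (U y - conj z • U x) =
      inner ℂ (a ⟨z, hz⟩ n) (y - conj z • x) := by
    intro n
    rw [← U.inner_map_map, hU (⟨z, hz⟩, n), map_sub, map_smul]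
  constructor
  · intro h n
    rw [hin]
    exact h _ (hmem ⟨z, hz⟩ n)
  · intro h n hn
    obtain ⟨k, rfl⟩ := hsurj ⟨z, hz⟩ n hn
    rw [← hin]
    exact h k

end Unitary

end PhillipsSymmetric

theorem mainTheorem5 {H : Type*} [NormedAddCommGroup H] [InnerProductSpace ℂ H]
    [CompleteSpace H] [TopologicalSpace.SeparableSpace H]
    (S : H →ₗ.[ℂ] H) (hclosed : S.IsClosed) (hsymm : PhillipsSymmetric.IsSymmetricOp S)
    (m : Cardinal.{0}) (hm : m ≠ 0) (hdef : PhillipsSymmetric.HasDefectNumbers S m m) :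
    (PhillipsSymmetric.IsPhillips S ↔
      ∃ (K₁ K₂ K₃ : Submodule ℂ H)
        (_ : CompleteSpace K₁) (_ : CompleteSpace K₂) (_ : CompleteSpace K₃),
        PhillipsSymmetric.IsOrthogonalSumOfParts S K₁ K₂ K₃ ∧
        (PhillipsSymmetric.IsSimple (PhillipsSymmetric.part S K₁) ∧
          PhillipsSymmetric.IsMaximalSymmetric (PhillipsSymmetric.part S K₁) ∧
          PhillipsSymmetric.HasDefectNumbers (PhillipsSymmetric.part S K₁) m 0) ∧
        (PhillipsSymmetric.IsSimple (PhillipsSymmetric.part S K₂) ∧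
          PhillipsSymmetric.IsMaximalSymmetric (PhillipsSymmetric.part S K₂) ∧
          PhillipsSymmetric.HasDefectNumbers (PhillipsSymmetric.part S K₂) 0 m) ∧
        IsSelfAdjoint (PhillipsSymmetric.part S K₃)) ∧
    (PhillipsSymmetric.IsPhillips S → PhillipsSymmetric.IsSimple S →
      ∀ (N : Type*) [NormedAddCommGroup N] [InnerProductSpace ℂ N] [CompleteSpace N],
        PhillipsSymmetric.HasHilbertDim N m →
        PhillipsSymmetric.UnitarilyEquivalent S (PhillipsSymmetric.momentum N)) := by
  refine ⟨PhillipsSymmetric.isPhillips_iff_exists_decomposition hclosed hsymm hm hdef,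
    fun hP hs N _ _ _ hN => ?_⟩
  have ho := hP.orthogonalDefects
  obtain ⟨Jp⟩ := hN.nonempty_linearIsometryEquiv hdef.1
  obtain ⟨Jm⟩ := hN.nonempty_linearIsometryEquiv hdef.2
  exact ho.unitarilyEquivalent_momentum hclosed hsymm (ho.residual_eq_bot hclosed hsymm hs) Jp Jm
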